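/- For an integer $y\ge 2$ let $\alpha_y(n)=1$ if every prime dividing $n$ is $>y$, and $\alpha_y(n)=0$ otherwise; let $P_y=\prod_{p\le y}(1-1/p)$ (here and below $p$ denotes a prime). For integers $X,H\ge 1$ put \[ V(X,H,y)=\frac1X\int_0^X\Big(\sum_{x<n\le x+H}\alpha_y(n)-HP_y\Big)^2dx, \] \[ M(H,y)=\prod_{2<p\le y}\Big(1-\frac2p\Big)\sum_{n\ge1}g_y(n)\Big\{\frac{H}{2n}\Big\}\Big(1-\Big\{\frac{H}{2n}\Big\}\Big), \] where $\{\cdot\}$ is the fractional part and $g_y$ is the multiplicative function supported on squarefree integers with $g_y(p)=p/(p-2)$ if $2<p\le y$ and $g_y(p)=0$ for all other primes $p$. For real $x\ge 1$ let \[ \Psi_\omega(x,y)=\sum_{\substack{n\le x\\ p\mid n\Rightarrow p\le y}}2^{\omega(n)}\mu^2(n), \] where $\omega(n)$ is the number of distinct prime factors of $n$ and $\mu$ is the M\"obius function. \textbf{Proposition.} There are an absolute constant $C>0$ and a function $\varepsilon:[1,\infty)\to[-1,1]$ with $\varepsilon(u)\to0$ as $u\to\infty$ such that, for all integers $y\ge2$,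 $H\ge1$, $X\ge1$ and all real $u\ge1$, \[ |V(X,H,y)-M(H,y)|\le C\,H^2\Big(P_y\,u^{-u(1+\varepsilon(u))}+\frac{\Psi_\omega(y^u,y)}{X}\Big). \] In other words, $V(X,H,y)=M(H,y)+O\big(H^2(P_yu^{-u(1+o(1))}+\Psi_\omega(y^u,y)/X)\big)$ with an absolute implied constant, the $o(1)$ being a bounded function of $u$ that tends to $0$ as $u\to\infty$. -/

import Mathlib

open scoped Classical in
/-- The indicator of the integers without prime factors `≤ y`. -/
noncomputable def alphaSifted (y n : ℕ) : ℝ :=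
  if ∀ p : ℕ, p.Prime → p ∣ n → y < p then 1 else 0

/-- The density `P_y = ∏_{p ≤ y} (1 - 1/p)` of the sifted integers. -/
noncomputable def siftedDensity (y : ℕ) : ℝ :=
  ∏ p ∈ (Finset.Icc 1 y).filter Nat.Prime, (1 - 1 / (p : ℝ))

/-- The variance `V(X,H,y)`. For `x ≥ 0`, the integers `n` with `x < n ≤ x + H` are those with
`⌊x⌋ < n ≤ ⌊x + H⌋`. -/
noncomputable def siftedVariance (X H y : ℕ) : ℝ :=
  (1 / (X : ℝ)) * ∫ x in (0 : ℝ)..(X : ℝ),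
    ((∑ n ∈ Finset.Ioc ⌊x⌋₊ ⌊x + (H : ℝ)⌋₊, alphaSifted y n) - (H : ℝ) * siftedDensity y) ^ 2

open scoped Classical in
/-- The multiplicative function `g_y`, supported on squarefree integers, with
`g_y(p) = p / (p - 2)` for primes `2 < p ≤ y` and `g_y(p) = 0` for all other primes. -/
noncomputable def gSifted (y n : ℕ) : ℝ :=
  if Squarefree n then
    ∏ p ∈ n.primeFactors, (if 2 < p ∧ p ≤ y then (p : ℝ) / ((p : ℝ) - 2) else 0)
  else 0

/-- The main term `M(H,y)`. The term `n = 0` of the series is zero because `g_y(0) = 0`, and only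
finitely many terms are nonzero (`gSifted_support_finite`). -/
noncomputable def siftedMainTerm (H y : ℕ) : ℝ :=
  (∏ p ∈ (Finset.Icc 1 y).filter (fun p => p.Prime ∧ 2 < p), (1 - 2 / (p : ℝ))) *
    ∑' n : ℕ, gSifted y n *
      (Int.fract ((H : ℝ) / (2 * (n : ℝ))) * (1 - Int.fract ((H : ℝ) / (2 * (n : ℝ)))))

/-- `Ψ_ω(x,y)`: the sum of `2^{ω(n)} μ(n)^2` over the `y`-friable integers `1 ≤ n ≤ x`. -/
noncomputable def friableOmegaSum (x : ℝ) (y : ℕ) : ℝ :=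
  ∑ n ∈ (Finset.Icc 1 ⌊x⌋₊).filter (fun n => ∀ p ∈ n.primeFactors, p ≤ y),
    (2 : ℝ) ^ (ArithmeticFunction.cardDistinctFactors n) *
      ((ArithmeticFunction.moebius n : ℤ) : ℝ) ^ 2

theorem gSifted_zero (y : ℕ) : gSifted y 0 = 0 := by
  simp [gSifted]

theorem gSifted_support_finite (y : ℕ) : (Function.support (gSifted y)).Finite := by
  refine ((Finset.Icc 1 y).powerset.image (fun s => ∏ p ∈ s, p)).finite_toSet.subset ?_
  intro n hn
  rw [Function.mem_support] at hn
  unfold gSifted at hn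
  split_ifs at hn with hsq
  · rw [Finset.prod_ne_zero_iff] at hn
    simp only [Finset.coe_image, Set.mem_image, Finset.mem_coe, Finset.mem_powerset]
    refine ⟨n.primeFactors, fun p hp => ?_, Nat.prod_primeFactors_of_squarefree hsq⟩
    have h := hn p hp
    rw [Finset.mem_Icc]
    by_cases hc : 2 < p ∧ p ≤ y
    · exact ⟨by omega, hc.2⟩
    · simp [hc] at h
  · exact absurd rfl hn

/-!
Expanding the square turns `V(X, H, y)` into correlations: the number of `m < X` such that neither
`m + i` nor `m + j` has a prime factor `≤ y`, for `1 ≤ i, j ≤ H`. If `i` and `j` have the same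
parity, this is a sieve problem of dimension two; otherwise the correlation vanishes.

Replacing each correlation by `X` times its density produces `M(H, y)` exactly. Indeed the density
is a combination, over the products `q` of distinct odd primes `≤ y`, of the conditions
`i ≡ j [MOD 2 * q]`, and such a congruence holds for `H² / 2q + 2q {H / 2q} (1 - {H / 2q})` pairs
`(i, j)`; the terms `H² / 2q` add up to `(H P_y)²`.

The errors are controlled by the Brun–Hooley sieve at level `y ^ u`. The primes `≤ y` are cut into
blocks at `y ^ (1 / 2 ^ (k * j))`, and inclusion–exclusion in the `j`-th block is truncated at
`n + 2 * j` primes. The products that survive are at most `y ^ (n * (1 + 2 / 2 ^ k) + 4)`, so that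
`n` may be taken close to `u`, while the truncation costs a relative error `O_k(1) ^ n / n!`, which
is `u ^ (-u * (1 + o(1)))`. A surviving `S` contributes at most `2 ^ #S` to the remainder by the
Chinese remainder theorem, and these contributions add up to at most `Ψ_ω(y ^ u, y)`.
-/

open Finset

section TruncatedInclusionExclusion

variable {ι : Type*}

/-- The expansion of `∏ i ∈ A, (1 - x i)` truncated to the products of fewer than `n` factors. -/
def truncatedProd {R : Type*} [CommRing R] (A : Finset ι) (n : ℕ) (x : ι → R) : R :=
  ∑ S ∈ A.powerset with #S < n, ∏ i ∈ S, -x i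

theorem truncatedProd_insert_succ [DecidableEq ι] {R : Type*} [CommRing R] {A : Finset ι} {a : ι}
    (ha : a ∉ A) (n : ℕ) (x : ι → R) :
    truncatedProd (insert a A) (n + 1) x =
      truncatedProd A (n + 1) x - x a * truncatedProd A n x := by
  have notMem {S : Finset ι} (hS : S ∈ A.powerset) : a ∉ S := fun h => ha (mem_powerset.1 hS h)
  simp only [truncatedProd, sum_filter, sum_powerset_insert ha, mul_sum, sub_eq_add_neg,
    ← sum_neg_distrib]
  congr 1
  refine sum_congr rfl fun S hS => ?_
  rw [card_insert_of_notMem (notMem hS), prod_insert (notMem hS)]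
  simp only [Nat.add_lt_add_iff_right]
  split_ifs <;> ring

theorem sum_powersetCard_insert_succ [DecidableEq ι] {R : Type*} [CommSemiring R]
    {A : Finset ι} {a : ι} (ha : a ∉ A) (n : ℕ) (x : ι → R) :
    ∑ S ∈ (insert a A).powersetCard (n + 1), ∏ i ∈ S, x i =
      ∑ S ∈ A.powersetCard (n + 1), ∏ i ∈ S, x i +
        x a * ∑ S ∈ A.powersetCard n, ∏ i ∈ S, x i := by
  have notMem {m : ℕ} {S : Finset ι} (hS : S ∈ A.powersetCard m) : a ∉ S :=
    fun h => ha ((mem_powersetCard.1 hS).1 h)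
  have hdisj : Disjoint (A.powersetCard (n + 1)) ((A.powersetCard n).image (insert a)) := by
    refine disjoint_right.2 fun S hS hS' => ?_
    obtain ⟨S, -, rfl⟩ := mem_image.1 hS
    exact notMem hS' (mem_insert_self a S)
  rw [powersetCard_succ_insert ha, sum_union hdisj, sum_image, mul_sum]
  · exact congrArg _ (sum_congr rfl fun S hS => prod_insert (notMem hS))
  · exact fun S hS S' hS' h => by
      rw [← erase_insert (notMem hS), h, erase_insert (notMem hS')]

theorem neg_one_pow_mul_prod_sub_truncatedProd_mem_Icc {A : Finset ι} {x : ι → ℝ}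
    (hx : ∀ i ∈ A, x i ∈ Set.Icc 0 1) (n : ℕ) :
    (-1) ^ n * (∏ i ∈ A, (1 - x i) - truncatedProd A n x) ∈
      Set.Icc 0 (∑ S ∈ A.powersetCard n, ∏ i ∈ S, x i) := by
  classical
  induction A using Finset.induction_on generalizing n with
  | empty => cases n <;> simp [truncatedProd, filter_singleton, powersetCard_eq_filter]
  | insert a A ha ih =>
    have hxA : ∀ i ∈ A, x i ∈ Set.Icc 0 1 := fun i hi => hx i (mem_insert_of_mem hi)
    obtain ⟨hxa, -⟩ := hx a (mem_insert_self a A)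
    cases n with
    | zero =>
      have hle : ∏ i ∈ insert a A, (1 - x i) ≤ 1 :=
        prod_le_one (fun i hi => sub_nonneg.2 (hx i hi).2) fun i hi => by linarith [(hx i hi).1]
      have hnonneg : 0 ≤ ∏ i ∈ insert a A, (1 - x i) :=
        prod_nonneg fun i hi => sub_nonneg.2 (hx i hi).2
      simpa [truncatedProd] using ⟨hnonneg, hle⟩
    | succ n =>
      obtain ⟨hlow, hupp⟩ := ih hxA (n + 1)
      obtain ⟨hlow', hupp'⟩ := ih hxA n
      have hrec : (-1) ^ (n + 1) *
          (∏ i ∈ insert a A, (1 - x i) - truncatedProd (insert a A) (n + 1) x) =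
          (-1) ^ (n + 1) * (∏ i ∈ A, (1 - x i) - truncatedProd A (n + 1) x) +
            x a * ((-1) ^ n * (∏ i ∈ A, (1 - x i) - truncatedProd A n x)) := by
        rw [prod_insert ha, truncatedProd_insert_succ ha]
        ring
      rw [hrec, sum_powersetCard_insert_succ ha]
      exact ⟨by positivity, by gcongr⟩

theorem prod_one_sub_le_truncatedProd {A : Finset ι} {x : ι → ℝ}
    (hx : ∀ i ∈ A, x i ∈ Set.Icc 0 1) {n : ℕ} (hn : Odd n) :
    ∏ i ∈ A, (1 - x i) ≤ truncatedProd A n x := by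
  have h := (neg_one_pow_mul_prod_sub_truncatedProd_mem_Icc hx n).1
  rw [hn.neg_one_pow] at h
  linarith

theorem truncatedProd_le_prod_one_sub_add {A : Finset ι} {x : ι → ℝ}
    (hx : ∀ i ∈ A, x i ∈ Set.Icc 0 1) {n : ℕ} (hn : Odd n) :
    truncatedProd A n x ≤
      ∏ i ∈ A, (1 - x i) + ∑ S ∈ A.powersetCard n, ∏ i ∈ S, x i := by
  have h := (neg_one_pow_mul_prod_sub_truncatedProd_mem_Icc hx n).2
  rw [hn.neg_one_pow] at h
  linarith

theorem sum_powersetCard_prod_le_pow_div_factorial {A : Finset ι} {x : ι → ℝ}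
    (hx : ∀ i ∈ A, 0 ≤ x i) (n : ℕ) :
    ∑ S ∈ A.powersetCard n, ∏ i ∈ S, x i ≤ (∑ i ∈ A, x i) ^ n / n.factorial := by
  classical
  induction A using Finset.induction_on generalizing n with
  | empty => cases n <;> simp [filter_singleton, powersetCard_eq_filter]
  | insert a A ha ih =>
    cases n with
    | zero => simp
    | succ n =>
      have hxA : ∀ i ∈ A, 0 ≤ x i := fun i hi => hx i (mem_insert_of_mem hi)
      have hxa : 0 ≤ x a := hx a (mem_insert_self a A)
      have hs : 0 ≤ ∑ i ∈ A, x i := sum_nonneg hxA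
      calc ∑ S ∈ (insert a A).powersetCard (n + 1), ∏ i ∈ S, x i
          ≤ (∑ i ∈ A, x i) ^ (n + 1) / (n + 1).factorial +
              x a * ((∑ i ∈ A, x i) ^ n / n.factorial) := by
            rw [sum_powersetCard_insert_succ ha]
            gcongr
            exacts [ih hxA (n + 1), ih hxA n]
        _ = ((∑ i ∈ A, x i) ^ (n + 1) +
              (n + 1 : ℕ) * (∑ i ∈ A, x i) ^ (n + 1 - 1) * x a) / (n + 1).factorial := by
            rw [Nat.factorial_succ, add_tsub_cancel_right]
            push_cast
            field_simp
        _ ≤ (∑ i ∈ insert a A, x i) ^ (n + 1) / (n + 1).factorial := by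
            rw [sum_insert ha, add_comm (x a)]
            gcongr
            exact pow_add_mul_le_add_pow hs (by positivity) (n + 1)

end TruncatedInclusionExclusion

section BrunHooley

variable {ι κ : Type*} [DecidableEq κ] {A : Finset ι} {J : ι → κ} {n : κ → ℕ}

theorem prod_sub_prod_le_sum_mul_prod_erase {T : Finset κ} {a b c : κ → ℝ}
    (ha : ∀ j ∈ T, 0 ≤ a j) (hab : ∀ j ∈ T, a j ≤ b j) (hbc : ∀ j ∈ T, b j ≤ a j + c j) :
    ∏ j ∈ T, b j - ∏ j ∈ T, a j ≤ ∑ l ∈ T, c l * ∏ j ∈ T.erase l, b j := by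
  induction T using Finset.induction_on with
  | empty => simp
  | insert k T hk ih =>
    have hmem {j : κ} (hj : j ∈ T) : j ∈ insert k T := mem_insert_of_mem hj
    have hak := ha k (mem_insert_self k T)
    have hkT {l : κ} (hl : l ∈ T) :
        ∏ j ∈ (insert k T).erase l, b j = b k * ∏ j ∈ T.erase l, b j := by
      rw [erase_insert_of_ne (ne_of_mem_of_not_mem hl hk).symm,
        prod_insert fun h => hk (mem_of_mem_erase h)]
    have hbk : 0 ≤ b k := hak.trans (hab k (mem_insert_self k T))
    have hb : 0 ≤ ∏ j ∈ T, b j := prod_nonneg fun j hj => (ha j (hmem hj)).trans (hab j (hmem hj))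
    have hle : ∏ j ∈ T, a j ≤ ∏ j ∈ T, b j :=
      prod_le_prod (fun j hj => ha j (hmem hj)) fun j hj => hab j (hmem hj)
    have ih := ih (fun j hj => ha j (hmem hj)) (fun j hj => hab j (hmem hj))
      fun j hj => hbc j (hmem hj)
    calc ∏ j ∈ insert k T, b j - ∏ j ∈ insert k T, a j
        = (b k - a k) * ∏ j ∈ T, b j + a k * (∏ j ∈ T, b j - ∏ j ∈ T, a j) := by
          rw [prod_insert hk, prod_insert hk]; ring
      _ ≤ c k * ∏ j ∈ T, b j + b k * ∑ l ∈ T, c l * ∏ j ∈ T.erase l, b j := by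
          gcongr
          · linarith [hbc k (mem_insert_self k T)]
          · exact hab k (mem_insert_self k T)
      _ = ∑ l ∈ insert k T, c l * ∏ j ∈ (insert k T).erase l, b j := by
          rw [sum_insert hk, erase_insert hk, mul_sum]
          congr 1
          refine sum_congr rfl fun l hl => ?_
          rw [hkT hl]; ring

theorem biUnion_attach_filter_eq [DecidableEq ι] {T : Finset κ} (hJ : ∀ i ∈ A, J i ∈ T) :
    (T.attach.biUnion fun j => {i ∈ A | J i = j.1}) = A := by
  ext i
  simpa using hJ i

theorem filter_biUnion_attach_eq [DecidableEq ι] {T : Finset κ} {F : ∀ j ∈ T, Finset ι}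
    (hF : ∀ j hj, ∀ i ∈ F j hj, J i = j) {j : κ} (hj : j ∈ T) :
    {i ∈ T.attach.biUnion fun j => F j.1 j.2 | J i = j} = F j hj := by
  ext i
  simp only [mem_filter, mem_biUnion, mem_attach, true_and, Subtype.exists]
  constructor
  · rintro ⟨⟨k, hk, hi⟩, rfl⟩
    obtain rfl := hF k hk i hi
    exact hi
  · exact fun hi => ⟨⟨j, hj, hi⟩, hF j hj i hi⟩

theorem prod_sum_powerset_fiber {R : Type*} [CommSemiring R]
    {T : Finset κ} (hJ : ∀ i ∈ A, J i ∈ T) (P : κ → Finset ι → Prop)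
    [∀ j, DecidablePred (P j)] (f : ι → R) :
    ∏ j ∈ T, ∑ S ∈ {i ∈ A | J i = j}.powerset with P j S, ∏ i ∈ S, f i =
      ∑ S ∈ A.powerset with ∀ j ∈ T, P j {i ∈ S | J i = j}, ∏ i ∈ S, f i := by
  classical
  rw [prod_sum]
  refine sum_bij' (fun F _ => T.attach.biUnion fun j => F j.1 j.2)
    (fun S _ j _ => {i ∈ S | J i = j}) ?_ ?_ ?_ ?_ ?_ <;>
    simp only [mem_pi, mem_filter, mem_powerset]
  · intro F hF
    refine ⟨biUnion_subset.2 fun j _ => (hF j.1 j.2).1.trans (filter_subset _ _),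
      fun j hj => ?_⟩
    rw [filter_biUnion_attach_eq (fun j hj i hi => (mem_filter.1 ((hF j hj).1 hi)).2) hj]
    exact (hF j hj).2
  · exact fun S hS j hj => ⟨filter_subset_filter _ hS.1, hS.2 j hj⟩
  · intro F hF
    funext j hj
    exact filter_biUnion_attach_eq (fun j hj i hi => (mem_filter.1 ((hF j hj).1 hi)).2) hj
  · exact fun S hS => biUnion_attach_filter_eq fun i hi => hJ i (hS.1 hi)
  · intro F hF
    have hdisj : Set.PairwiseDisjoint (T.attach : Set T) fun j => F j.1 j.2 := by
      refine fun j _ k _ hjk => disjoint_left.2 fun i hi hi' => hjk (Subtype.ext ?_)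
      rw [← (mem_filter.1 ((hF j.1 j.2).1 hi)).2, (mem_filter.1 ((hF k.1 k.2).1 hi')).2]
    exact (prod_biUnion hdisj).symm

/-- The products of elements of these sets make up Brun's and Hooley's upper bound for a product
over `A`: fewer than `n j` elements are chosen from each block `{i ∈ A | J i = j}`. -/
def upperSieveSets (A : Finset ι) (J : ι → κ) (n : κ → ℕ) : Finset (Finset ι) :=
  {S ∈ A.powerset | ∀ j ∈ A.image J, #{i ∈ S | J i = j} < n j}

/-- The choices that meet the bound `n l` in block `l` and stay below it in all other blocks. -/
def overflowSieveSets (A : Finset ι) (J : ι → κ) (n : κ → ℕ) (l : κ) : Finset (Finset ι) :=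
  {S ∈ A.powerset | ∀ j ∈ A.image J,
    if j = l then #{i ∈ S | J i = j} = n j else #{i ∈ S | J i = j} < n j}

/-- The products of elements of these sets make up Brun's and Hooley's lower bound for a product
over `A`: the bound `n j` may be met in at most one block. -/
def lowerSieveSets [DecidableEq ι] (A : Finset ι) (J : ι → κ) (n : κ → ℕ) : Finset (Finset ι) :=
  upperSieveSets A J n ∪ (A.image J).biUnion (overflowSieveSets A J n)

/-- The difference of Brun's and Hooley's upper and lower bounds for `∏ i ∈ A, (1 - x i)`. -/
def sieveGap (A : Finset ι) (J : ι → κ) (n : κ → ℕ) (x : ι → ℝ) : ℝ :=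
  ∑ l ∈ A.image J, (∑ S ∈ {i ∈ A | J i = l}.powersetCard (n l), ∏ i ∈ S, x i) *
    ∏ j ∈ (A.image J).erase l, truncatedProd {i ∈ A | J i = j} (n j) x

theorem sum_upperSieveSets (x : ι → ℝ) :
    ∑ S ∈ upperSieveSets A J n, ∏ i ∈ S, -x i =
      ∏ j ∈ A.image J, truncatedProd {i ∈ A | J i = j} (n j) x :=
  (prod_sum_powerset_fiber (fun _ => mem_image_of_mem J) (fun j S => #S < n j) _).symm

theorem sum_overflowSieveSets {l : κ} (hl : l ∈ A.image J) (hn : Odd (n l)) (x : ι → ℝ) :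
    ∑ S ∈ overflowSieveSets A J n l, ∏ i ∈ S, -x i =
      -((∑ S ∈ {i ∈ A | J i = l}.powersetCard (n l), ∏ i ∈ S, x i) *
        ∏ j ∈ (A.image J).erase l, truncatedProd {i ∈ A | J i = j} (n j) x) := by
  have hblock : ∑ S ∈ {i ∈ A | J i = l}.powersetCard (n l), ∏ i ∈ S, -x i =
      -∑ S ∈ {i ∈ A | J i = l}.powersetCard (n l), ∏ i ∈ S, x i := by
    rw [← sum_neg_distrib]
    refine sum_congr rfl fun S hS => ?_
    rw [prod_neg, (mem_powersetCard.1 hS).2, hn.neg_one_pow, neg_one_mul]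
  rw [← neg_mul, ← hblock, overflowSieveSets,
    ← prod_sum_powerset_fiber (fun _ => mem_image_of_mem J)
      (fun j S => if j = l then #S = n j else #S < n j), ← mul_prod_erase _ _ hl]
  simp only [if_true, powersetCard_eq_filter]
  congr 1
  refine prod_congr rfl fun j hj => ?_
  simp only [if_neg (ne_of_mem_erase hj), truncatedProd]

theorem sum_lowerSieveSets [DecidableEq ι] (hn : ∀ j, Odd (n j)) (x : ι → ℝ) :
    ∑ S ∈ lowerSieveSets A J n, ∏ i ∈ S, -x i =
      ∑ S ∈ upperSieveSets A J n, ∏ i ∈ S, -x i - sieveGap A J n x := by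
  have hupper : Disjoint (upperSieveSets A J n)
      ((A.image J).biUnion (overflowSieveSets A J n)) := by
    refine disjoint_left.2 fun S hS hS' => ?_
    obtain ⟨l, hl, hSl⟩ := mem_biUnion.1 hS'
    have hlt := (mem_filter.1 hS).2 l hl
    have heq := (mem_filter.1 hSl).2 l hl
    rw [if_pos rfl] at heq
    exact hlt.ne heq
  have hoverflow : Set.PairwiseDisjoint (A.image J : Set κ) (overflowSieveSets A J n) := by
    refine fun l hl k _ hlk => disjoint_left.2 fun S hSl hSk => ?_
    have heq := (mem_filter.1 hSl).2 l hl
    have hlt := (mem_filter.1 hSk).2 l hl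
    rw [if_pos rfl] at heq
    rw [if_neg hlk] at hlt
    exact hlt.ne heq
  rw [lowerSieveSets, sum_union hupper, sum_biUnion hoverflow, sieveGap, sub_eq_add_neg,
    ← sum_neg_distrib]
  exact congrArg _ (sum_congr rfl fun l hl => sum_overflowSieveSets hl (hn l) x)

theorem upperSieveSets_subset_lowerSieveSets [DecidableEq ι] :
    upperSieveSets A J n ⊆ lowerSieveSets A J n :=
  subset_union_left

theorem subset_of_mem_lowerSieveSets [DecidableEq ι] {S : Finset ι}
    (hS : S ∈ lowerSieveSets A J n) : S ⊆ A := by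
  simp only [lowerSieveSets, upperSieveSets, overflowSieveSets, mem_union, mem_biUnion, mem_filter,
    mem_powerset] at hS
  obtain h | ⟨_, _, h⟩ := hS <;> exact h.1

theorem card_filter_le_of_mem_lowerSieveSets [DecidableEq ι] {S : Finset ι}
    (hS : S ∈ lowerSieveSets A J n) {j : κ} (hj : j ∈ A.image J) :
    #{i ∈ S | J i = j} ≤ n j := by
  simp only [lowerSieveSets, upperSieveSets, overflowSieveSets, mem_union, mem_biUnion,
    mem_filter] at hS
  obtain h | ⟨l, _, h⟩ := hS
  · exact (h.2 j hj).le
  · have hcard := h.2 j hj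
    split_ifs at hcard
    exacts [hcard.le, hcard.le]

variable {x : ι → ℝ}

theorem prod_image_prod_filter_eq {R : Type*} [CommMonoid R] (f : ι → R) :
    ∏ j ∈ A.image J, ∏ i ∈ A with J i = j, f i = ∏ i ∈ A, f i :=
  prod_fiberwise_of_maps_to (fun _ => mem_image_of_mem J) f

theorem prod_one_sub_le_sum_upperSieveSets (hx : ∀ i ∈ A, x i ∈ Set.Icc 0 1)
    (hn : ∀ j, Odd (n j)) :
    ∏ i ∈ A, (1 - x i) ≤ ∑ S ∈ upperSieveSets A J n, ∏ i ∈ S, -x i := by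
  rw [sum_upperSieveSets, ← prod_image_prod_filter_eq (J := J)]
  exact prod_le_prod
    (fun j _ => prod_nonneg fun i hi => sub_nonneg.2 (hx i (mem_filter.1 hi).1).2)
    fun j _ => prod_one_sub_le_truncatedProd (fun i hi => hx i (mem_filter.1 hi).1) (hn j)

theorem sum_lowerSieveSets_le_prod_one_sub [DecidableEq ι] (hx : ∀ i ∈ A, x i ∈ Set.Icc 0 1)
    (hn : ∀ j, Odd (n j)) :
    ∑ S ∈ lowerSieveSets A J n, ∏ i ∈ S, -x i ≤ ∏ i ∈ A, (1 - x i) := by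
  have hxJ (j : κ) : ∀ i ∈ {i ∈ A | J i = j}, x i ∈ Set.Icc 0 1 :=
    fun i hi => hx i (mem_filter.1 hi).1
  rw [sum_lowerSieveSets hn, sum_upperSieveSets, ← prod_image_prod_filter_eq (J := J),
    sub_le_comm]
  exact prod_sub_prod_le_sum_mul_prod_erase
    (fun j _ => prod_nonneg fun i hi => sub_nonneg.2 (hxJ j i hi).2)
    (fun j _ => prod_one_sub_le_truncatedProd (hxJ j) (hn j))
    fun j _ => truncatedProd_le_prod_one_sub_add (hxJ j) (hn j)

theorem abs_sum_prod_one_sub_sub_le [DecidableEq ι] {Ω : Type*} {B : Finset Ω} {X : ℝ} (hX : 0 ≤ X)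
    {x : ι → Ω → ℝ} (hx : ∀ i ∈ A, ∀ ω ∈ B, x i ω ∈ Set.Icc 0 1)
    {ρ : ι → ℝ} (hρ : ∀ i ∈ A, ρ i ∈ Set.Icc 0 1) (hn : ∀ j, Odd (n j)) {E : Finset ι → ℝ}
    (hE : ∀ S ∈ lowerSieveSets A J n, |∑ ω ∈ B, ∏ i ∈ S, x i ω - X * ∏ i ∈ S, ρ i| ≤ E S) :
    |∑ ω ∈ B, ∏ i ∈ A, (1 - x i ω) - X * ∏ i ∈ A, (1 - ρ i)| ≤
      X * sieveGap A J n ρ + ∑ S ∈ lowerSieveSets A J n, E S := by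
  have herror {𝓢 : Finset (Finset ι)} (h𝓢 : 𝓢 ⊆ lowerSieveSets A J n) :
      |∑ ω ∈ B, ∑ S ∈ 𝓢, ∏ i ∈ S, -x i ω - X * ∑ S ∈ 𝓢, ∏ i ∈ S, -ρ i| ≤
        ∑ S ∈ lowerSieveSets A J n, E S := by
    rw [sum_comm, mul_sum, ← sum_sub_distrib]
    calc |∑ S ∈ 𝓢, (∑ ω ∈ B, ∏ i ∈ S, -x i ω - X * ∏ i ∈ S, -ρ i)|
        ≤ ∑ S ∈ 𝓢, |∑ ω ∈ B, ∏ i ∈ S, -x i ω - X * ∏ i ∈ S, -ρ i| := abs_sum_le_sum_abs _ _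
      _ = ∑ S ∈ 𝓢, |∑ ω ∈ B, ∏ i ∈ S, x i ω - X * ∏ i ∈ S, ρ i| := by
          refine sum_congr rfl fun S _ => ?_
          simp only [prod_neg, ← mul_sum]
          rw [mul_left_comm, ← mul_sub, abs_mul, abs_pow, abs_neg, abs_one, one_pow, one_mul]
      _ ≤ ∑ S ∈ lowerSieveSets A J n, |∑ ω ∈ B, ∏ i ∈ S, x i ω - X * ∏ i ∈ S, ρ i| :=
          sum_le_sum_of_subset_of_nonneg h𝓢 fun _ _ _ => abs_nonneg _
      _ ≤ ∑ S ∈ lowerSieveSets A J n, E S := sum_le_sum hE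
  have hupper := (abs_le.1 (herror upperSieveSets_subset_lowerSieveSets)).2
  have hlower := (abs_le.1 (herror (Subset.refl (lowerSieveSets A J n)))).1
  have hxupper : ∑ ω ∈ B, ∏ i ∈ A, (1 - x i ω) ≤
      ∑ ω ∈ B, ∑ S ∈ upperSieveSets A J n, ∏ i ∈ S, -x i ω :=
    sum_le_sum fun ω hω => prod_one_sub_le_sum_upperSieveSets (fun i hi => hx i hi ω hω) hn
  have hxlower : ∑ ω ∈ B, ∑ S ∈ lowerSieveSets A J n, ∏ i ∈ S, -x i ω ≤
      ∑ ω ∈ B, ∏ i ∈ A, (1 - x i ω) :=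
    sum_le_sum fun ω hω => sum_lowerSieveSets_le_prod_one_sub (fun i hi => hx i hi ω hω) hn
  have hρupper := mul_le_mul_of_nonneg_left
    (prod_one_sub_le_sum_upperSieveSets (J := J) hρ hn) hX
  have hρlower := mul_le_mul_of_nonneg_left
    (sum_lowerSieveSets_le_prod_one_sub (J := J) hρ hn) hX
  have hgap := congrArg (X * ·) (sum_lowerSieveSets (A := A) (J := J) hn ρ)
  simp only [mul_sub] at hgap
  exact abs_le.2 ⟨by linarith, by linarith⟩

theorem prod_one_sub_filter_nonneg (hx : ∀ i ∈ A, x i ∈ Set.Icc 0 1) (j : κ) :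
    0 ≤ ∏ i ∈ A with J i = j, (1 - x i) :=
  prod_nonneg fun i hi => sub_nonneg.2 (hx i (mem_filter.1 hi).1).2

variable {δ : κ → ℝ}

theorem truncatedProd_filter_nonneg (hx : ∀ i ∈ A, x i ∈ Set.Icc 0 1) (hn : ∀ j, Odd (n j))
    (j : κ) : 0 ≤ truncatedProd {i ∈ A | J i = j} (n j) x :=
  (prod_one_sub_filter_nonneg hx j).trans
    (prod_one_sub_le_truncatedProd (fun i hi => hx i (mem_filter.1 hi).1) (hn j))

theorem prod_erase_truncatedProd_le (hx : ∀ i ∈ A, x i ∈ Set.Icc 0 1) (hn : ∀ j, Odd (n j))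
    (hδ : ∀ j ∈ A.image J, 0 ≤ δ j)
    (htail : ∀ j ∈ A.image J, ∑ S ∈ {i ∈ A | J i = j}.powersetCard (n j), ∏ i ∈ S, x i ≤
      δ j * ∏ i ∈ A with J i = j, (1 - x i)) (l : κ) :
    ∏ j ∈ (A.image J).erase l, truncatedProd {i ∈ A | J i = j} (n j) x ≤
      (∏ j ∈ (A.image J).erase l, ∏ i ∈ A with J i = j, (1 - x i)) *
        Real.exp (∑ j ∈ A.image J, δ j) := by
  have hP (j : κ) := prod_one_sub_filter_nonneg (J := J) hx j
  have hblock {j : κ} (hj : j ∈ A.image J) : truncatedProd {i ∈ A | J i = j} (n j) x ≤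
      (∏ i ∈ A with J i = j, (1 - x i)) * Real.exp (δ j) :=
    calc truncatedProd {i ∈ A | J i = j} (n j) x
        ≤ ∏ i ∈ A with J i = j, (1 - x i) + δ j * ∏ i ∈ A with J i = j, (1 - x i) :=
          (truncatedProd_le_prod_one_sub_add (fun i hi => hx i (mem_filter.1 hi).1) (hn j)).trans
            (by gcongr; exact htail j hj)
      _ = (∏ i ∈ A with J i = j, (1 - x i)) * (δ j + 1) := by ring
      _ ≤ (∏ i ∈ A with J i = j, (1 - x i)) * Real.exp (δ j) := by
          gcongr
          exacts [hP j, Real.add_one_le_exp _]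
  refine (prod_le_prod (fun j _ => truncatedProd_filter_nonneg hx hn j)
    fun j hj => hblock (mem_of_mem_erase hj)).trans ?_
  rw [prod_mul_distrib, ← Real.exp_sum]
  gcongr
  · exact prod_nonneg fun j _ => hP j
  · exact fun i hi _ => hδ i hi
  · exact erase_subset l _

theorem sieveGap_le (hx : ∀ i ∈ A, x i ∈ Set.Icc 0 1) (hn : ∀ j, Odd (n j))
    (hδ : ∀ j ∈ A.image J, 0 ≤ δ j)
    (htail : ∀ j ∈ A.image J, ∑ S ∈ {i ∈ A | J i = j}.powersetCard (n j), ∏ i ∈ S, x i ≤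
      δ j * ∏ i ∈ A with J i = j, (1 - x i)) :
    sieveGap A J n x ≤
      (∏ i ∈ A, (1 - x i)) * ((∑ j ∈ A.image J, δ j) * Real.exp (∑ j ∈ A.image J, δ j)) := by
  rw [sieveGap, sum_mul, mul_sum]
  refine sum_le_sum fun l hl => ?_
  calc _ ≤ (δ l * ∏ i ∈ A with J i = l, (1 - x i)) *
        ((∏ j ∈ (A.image J).erase l, ∏ i ∈ A with J i = j, (1 - x i)) *
          Real.exp (∑ j ∈ A.image J, δ j)) := by
        gcongr
        · exact prod_nonneg fun j _ => truncatedProd_filter_nonneg hx hn j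
        · exact mul_nonneg (hδ l hl) (prod_one_sub_filter_nonneg hx l)
        · exact htail l hl
        · exact prod_erase_truncatedProd_le hx hn hδ htail l
    _ = (∏ i ∈ A, (1 - x i)) * (δ l * Real.exp (∑ j ∈ A.image J, δ j)) := by
        rw [← prod_image_prod_filter_eq (A := A) (J := J), ← mul_prod_erase _ _ hl]
        ring

end BrunHooley

section ResidueClasses

theorem abs_count_modEq_sub_le (X r : ℕ) {q : ℕ} (hq : 0 < q) :
    |(X.count (· ≡ r [MOD q]) : ℝ) - X / q| ≤ 1 := by
  have hq' : (0 : ℝ) < q := by exact_mod_cast hq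
  have hdiv : (X : ℝ) / q = (X / q : ℕ) + (X % q : ℕ) / q := by
    rw [div_eq_iff hq'.ne', add_mul, div_mul_cancel₀ _ hq'.ne', mul_comm]
    exact_mod_cast (Nat.div_add_mod X q).symm
  have hlt : ((X % q : ℕ) : ℝ) / q < 1 := (div_lt_one hq').2 (by exact_mod_cast Nat.mod_lt X hq)
  have hnonneg : (0 : ℝ) ≤ (X % q : ℕ) / q := by positivity
  rw [Nat.count_modEq_card X hq, hdiv, abs_le]
  push_cast
  split_ifs <;> constructor <;> linarith

theorem abs_card_filter_cast_mem_sub_le {q : ℕ} [NeZero q] (D : Finset (ZMod q)) (X : ℕ) :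
    |(#{m ∈ range X | ((m : ℕ) : ZMod q) ∈ D} : ℝ) - X * (#D / q)| ≤ #D := by
  have hclass (a : ZMod q) :
      #{m ∈ range X | ((m : ℕ) : ZMod q) = a} = X.count (· ≡ a.val [MOD q]) := by
    simp only [Nat.count_eq_card_filter_range, ← ZMod.natCast_eq_natCast_iff, ZMod.natCast_zmod_val]
  have hcard : (#{m ∈ range X | ((m : ℕ) : ZMod q) ∈ D} : ℝ) - X * (#D / q) =
      ∑ a ∈ D, ((X.count (· ≡ a.val [MOD q]) : ℝ) - X / q) := by
    rw [card_eq_sum_card_fiberwise (f := fun m : ℕ => (m : ZMod q)) (t := D)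
      fun m hm => by simpa using (mem_filter.1 hm).2, sum_sub_distrib, sum_const, nsmul_eq_mul,
      Nat.cast_sum]
    congr 1
    · refine sum_congr rfl fun a ha => ?_
      rw [← hclass, filter_filter]
      congr 2
      ext m
      aesop
    · ring
  rw [hcard]
  refine (abs_sum_le_sum_abs _ _).trans ((sum_le_sum fun a _ =>
    abs_count_modEq_sub_le X a.val (NeZero.pos q)).trans ?_)
  simp

theorem abs_card_filter_forall_cast_mem_sub_le (Ω : ∀ p : ℕ, Finset (ZMod p)) {S : Finset ℕ}
    (hS : ∀ p ∈ S, p.Prime) (X : ℕ) :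
    |(#{m ∈ range X | ∀ p ∈ S, ((m : ℕ) : ZMod p) ∈ Ω p} : ℝ) - X * ∏ p ∈ S, (#(Ω p) / p : ℝ)| ≤
      ∏ p ∈ S, (#(Ω p) : ℝ) := by
  have hcoprime : Pairwise (Function.onFun Nat.Coprime fun p : S => (p : ℕ)) := fun p q hpq =>
    (Nat.coprime_primes (hS p p.2) (hS q q.2)).2 (Subtype.coe_injective.ne hpq)
  have (p : S) : NeZero (p : ℕ) := ⟨(hS p p.2).ne_zero⟩
  let crt := ZMod.prodEquivPi (fun p : S => (p : ℕ)) hcoprime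
  let D := (Fintype.piFinset fun p : S => Ω p).map crt.toEquiv.symm.toEmbedding
  have hD : #D = ∏ p ∈ S, #(Ω p) := by
    rw [card_map, Fintype.card_piFinset, prod_coe_sort S fun p => #(Ω p)]
  have hmem (m : ℕ) : (m : ZMod (∏ p : S, (p : ℕ))) ∈ D ↔ ∀ p ∈ S, (m : ZMod p) ∈ Ω p := by
    simp only [D, mem_map_equiv, Fintype.mem_piFinset, Equiv.symm_symm, RingEquiv.toEquiv_eq_coe,
      EquivLike.coe_coe, map_natCast, Pi.natCast_apply, Subtype.forall]
  have : NeZero (∏ p : S, (p : ℕ)) := ⟨prod_ne_zero_iff.2 fun p _ => (hS p p.2).ne_zero⟩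
  have h := abs_card_filter_cast_mem_sub_le D X
  simpa only [hmem, hD, Nat.cast_prod, prod_coe_sort S fun p => (p : ℝ), ← prod_div_distrib] using h

end ResidueClasses

section PrimeReciprocals

theorem sum_inv_primes_le_of_log_eq {A : Finset ℕ} {i : ℕ} (hi : 1 ≤ i) (hA : ∀ p ∈ A, p.Prime)
    (hlog : ∀ p ∈ A, Nat.log 2 p = i) : ∑ p ∈ A, (1 : ℝ) / p ≤ 4 / i := by
  have hge (p) (hp : p ∈ A) : 2 ^ i ≤ p := hlog p hp ▸ Nat.pow_log_le_self 2 (hA p hp).ne_zero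
  have hlt (p) (hp : p ∈ A) : p < 2 ^ (i + 1) :=
    hlog p hp ▸ Nat.lt_pow_succ_log_self one_lt_two p
  have hpow : (2 ^ i) ^ #A ≤ 4 ^ 2 ^ (i + 1) := by
    calc (2 ^ i) ^ #A ≤ ∏ p ∈ A, p := pow_card_le_prod A _ _ hge
      _ ≤ primorial (2 ^ (i + 1)) := by
          refine prod_le_prod_of_subset_of_one_le' (fun p hp => ?_)
            fun p hp _ => (mem_filter.1 hp).2.one_le
          exact mem_filter.2 ⟨mem_range.2 (by linarith [hlt p hp]), hA p hp⟩
      _ ≤ 4 ^ 2 ^ (i + 1) := primorial_le_four_pow _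
  have hcard : i * #A ≤ 4 * 2 ^ i := by
    rw [← pow_mul, show (4 : ℕ) = 2 ^ 2 by norm_num, ← pow_mul,
      Nat.pow_le_pow_iff_right one_lt_two, pow_succ] at hpow
    linarith
  calc ∑ p ∈ A, (1 : ℝ) / p ≤ ∑ p ∈ A, (1 : ℝ) / 2 ^ i := by
        gcongr with p hp
        exact_mod_cast hge p hp
    _ = #A / 2 ^ i := by rw [sum_const, nsmul_eq_mul, mul_one_div]
    _ ≤ 4 / i := by
        rw [div_le_div_iff₀ (by positivity) (by exact_mod_cast hi), mul_comm]
        exact_mod_cast hcard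

theorem sum_inv_primes_le_of_lt_sq {A : Finset ℕ} {x : ℕ} (hx : 2 ≤ x) (hA : ∀ p ∈ A, p.Prime)
    (hge : ∀ p ∈ A, x ≤ p) (hlt : ∀ p ∈ A, p < x ^ 2) : ∑ p ∈ A, (1 : ℝ) / p ≤ 12 := by
  set a := Nat.log 2 x
  have ha : 1 ≤ a := Nat.log_pos one_lt_two hx
  have hmaps : ∀ p ∈ A, Nat.log 2 p ∈ Ico a (2 * a + 2) := fun p hp => by
    refine mem_Ico.2 ⟨Nat.log_mono_right (hge p hp), Nat.log_lt_of_lt_pow (hA p hp).ne_zero ?_⟩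
    calc p < x ^ 2 := hlt p hp
      _ ≤ (2 ^ (a + 1)) ^ 2 := Nat.pow_le_pow_left (Nat.lt_pow_succ_log_self one_lt_two x).le 2
      _ = 2 ^ (2 * a + 2) := by rw [← pow_mul, Nat.add_mul, mul_comm a, one_mul]
  calc ∑ p ∈ A, (1 : ℝ) / p
      = ∑ i ∈ Ico a (2 * a + 2), ∑ p ∈ A with Nat.log 2 p = i, (1 : ℝ) / p :=
        (sum_fiberwise_of_maps_to hmaps _).symm
    _ ≤ ∑ _i ∈ Ico a (2 * a + 2), (4 : ℝ) / a := by
        refine sum_le_sum fun i hi => ?_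
        have hai : a ≤ i := (mem_Ico.1 hi).1
        refine (sum_inv_primes_le_of_log_eq (ha.trans hai) (fun p hp => hA p (mem_filter.1 hp).1)
          fun p hp => (mem_filter.1 hp).2).trans ?_
        gcongr
    _ = (a + 2) * (4 / a) := by
        rw [sum_const, Nat.card_Ico, nsmul_eq_mul, show 2 * a + 2 - a = a + 2 by omega]
        push_cast
        ring
    _ ≤ 12 := by
        have ha' : (1 : ℝ) ≤ a := by exact_mod_cast ha
        rw [← mul_div_assoc, div_le_iff₀ (by linarith)]
        linarith

theorem sum_inv_primes_le_of_lt_pow {A : Finset ℕ} {x : ℕ} (hx : 2 ≤ x) (k : ℕ)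
    (hA : ∀ p ∈ A, p.Prime) (hge : ∀ p ∈ A, x ≤ p) (hlt : ∀ p ∈ A, p < x ^ 2 ^ k) :
    ∑ p ∈ A, (1 : ℝ) / p ≤ 12 * k := by
  induction k generalizing A with
  | zero =>
    have hempty : A = ∅ := eq_empty_of_forall_notMem fun p hp => by
      have := hge p hp
      have := hlt p hp
      simp only [pow_zero, pow_one] at this
      omega
    simp [hempty]
  | succ k ih =>
    rw [← sum_filter_add_sum_filter_not A (· < x ^ 2 ^ k)]
    have hsmall := ih (A := A.filter (· < x ^ 2 ^ k)) (fun p hp => hA p (mem_filter.1 hp).1)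
      (fun p hp => hge p (mem_filter.1 hp).1) fun p hp => (mem_filter.1 hp).2
    have hlarge := sum_inv_primes_le_of_lt_sq (A := A.filter (¬ · < x ^ 2 ^ k))
      (hx.trans (Nat.le_self_pow (by positivity) x)) (fun p hp => hA p (mem_filter.1 hp).1)
      (fun p hp => not_lt.1 (mem_filter.1 hp).2) fun p hp => by
        rw [← pow_mul, ← pow_succ]
        exact hlt p (mem_filter.1 hp).1
    push_cast
    linarith

theorem sum_inv_primes_le_of_forall_lt_pow {A : Finset ℕ} (hA : ∀ p ∈ A, p.Prime) (k : ℕ)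
    (h : ∀ p ∈ A, ∀ q ∈ A, q < p ^ 2 ^ k) : ∑ p ∈ A, (1 : ℝ) / p ≤ 12 * k := by
  rcases A.eq_empty_or_nonempty with rfl | hne
  · simp
  · have hmin := A.min'_mem hne
    exact sum_inv_primes_le_of_lt_pow (hA _ hmin).two_le k hA (fun p hp => A.min'_le p hp)
      fun p hp => h _ hmin p hp

theorem exp_neg_div_le_one_sub_div {p ν : ℕ} (h : ν < p) :
    Real.exp (-(ν * (ν + 1) / p)) ≤ 1 - (ν : ℝ) / p := by
  have hνp : (ν : ℝ) + 1 ≤ p := by exact_mod_cast h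
  have hp : (0 : ℝ) < p := by linarith [(Nat.cast_nonneg ν : (0 : ℝ) ≤ ν)]
  have hpos : 0 < 1 - (ν : ℝ) / p := by
    rw [one_sub_div hp.ne']
    exact div_pos (by linarith) hp
  rw [← Real.le_log_iff_exp_le hpos]
  refine le_trans ?_ (Real.one_sub_inv_le_log_of_pos hpos)
  have hinv : 1 - (1 - (ν : ℝ) / p)⁻¹ = -(ν / (p - ν)) := by
    have : (p : ℝ) - ν ≠ 0 := by linarith
    rw [one_sub_div hp.ne']
    field_simp
    ring
  rw [hinv, neg_le_neg_iff, div_le_div_iff₀ (by linarith) hp]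
  nlinarith [mul_nonneg (sq_nonneg (ν : ℝ)) (sub_nonneg.2 hνp)]

theorem exp_neg_six_mul_sum_inv_le_prod {A : Finset ℕ} {ν : ℕ → ℕ}
    (hν : ∀ p ∈ A, ν p ≤ 2 ∧ ν p < p) :
    Real.exp (-(6 * ∑ p ∈ A, (1 : ℝ) / p)) ≤ ∏ p ∈ A, (1 - (ν p : ℝ) / p) := by
  rw [mul_sum, ← sum_neg_distrib, Real.exp_sum]
  refine prod_le_prod (fun _ _ => (Real.exp_pos _).le) fun p hp => ?_
  refine le_trans (Real.exp_le_exp.2 ?_) (exp_neg_div_le_one_sub_div (hν p hp).2)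
  rw [neg_le_neg_iff, mul_one_div]
  gcongr
  exact_mod_cast (Nat.mul_le_mul (hν p hp).1 (Nat.succ_le_succ (hν p hp).1) : _ ≤ 2 * 3)

end PrimeReciprocals

section PrimeBlocks

/-- The index of the block containing the prime `p ≤ y` when the primes up to `y` are cut at the
points `y ^ (1 / K ^ j)`: the `j` with `p ^ K ^ j ≤ y < p ^ K ^ (j + 1)`. -/
def primeBlock (y K p : ℕ) : ℕ := Nat.log K (Nat.log p y)

theorem pow_primeBlock_le {y K p : ℕ} (hp : 1 < p) (hpy : p ≤ y) :
    p ^ K ^ primeBlock y K p ≤ y :=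
  calc p ^ K ^ primeBlock y K p ≤ p ^ Nat.log p y :=
        Nat.pow_le_pow_right (by omega) (Nat.pow_log_le_self K (Nat.log_pos hp hpy).ne')
    _ ≤ y := Nat.pow_log_le_self p (by omega)

theorem lt_pow_primeBlock_succ {y K p : ℕ} (hK : 1 < K) (hp : 1 < p) :
    y < p ^ K ^ (primeBlock y K p + 1) :=
  (Nat.lt_pow_succ_log_self hp y).trans_le
    (Nat.pow_le_pow_right (by omega) (Nat.lt_pow_succ_log_self hK _))

theorem log_le_of_primeBlock {y K p : ℕ} (hK : 0 < K) (hp : 1 < p) (hpy : p ≤ y) :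
    Real.log p ≤ (1 / K) ^ primeBlock y K p * Real.log y := by
  have hlog : Real.log (p ^ K ^ primeBlock y K p : ℕ) ≤ Real.log y :=
    Real.log_le_log (by exact_mod_cast pow_pos (by omega) _)
      (by exact_mod_cast pow_primeBlock_le hp hpy)
  have : (0 : ℝ) < K := by exact_mod_cast hK
  rw [one_div, inv_pow, inv_mul_eq_div, le_div_iff₀ (by positivity), mul_comm]
  simpa only [Nat.cast_pow, Real.log_pow] using hlog

theorem sum_inv_primeBlock_le {y k : ℕ} (hk : 1 ≤ k) (j : ℕ) :
    ∑ p ∈ y.primesLE with primeBlock y (2 ^ k) p = j, (1 : ℝ) / p ≤ 12 * k := by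
  refine sum_inv_primes_le_of_forall_lt_pow
    (fun p hp => Nat.prime_of_mem_primesLE (mem_filter.1 hp).1) k fun p hp q hq => ?_
  simp only [mem_filter, Nat.mem_primesLE] at hp hq
  have hq_le := pow_primeBlock_le (K := 2 ^ k) hq.1.2.one_lt hq.1.1
  have hlt_p := lt_pow_primeBlock_succ (y := y) (Nat.one_lt_two_pow (by omega : k ≠ 0))
    hp.1.2.one_lt
  rw [hq.2] at hq_le
  rw [hp.2, pow_succ, mul_comm, pow_mul] at hlt_p
  exact lt_of_pow_lt_pow_left₀ _ (Nat.zero_le _) (hq_le.trans_lt hlt_p)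

theorem sum_add_two_mul_mul_pow_le {n r : ℝ} (hn : 0 ≤ n) (hr0 : 0 ≤ r) (hr : r ≤ 1 / 2)
    (s : Finset ℕ) : ∑ j ∈ s, (n + 2 * j) * r ^ j ≤ n * (1 + 2 * r) + 4 := by
  have hgeom := hasSum_geometric_of_lt_one hr0 (by linarith)
  have harith := hasSum_coe_mul_geometric_of_norm_lt_one (r := r)
    (by rw [Real.norm_eq_abs, abs_of_nonneg hr0]; linarith)
  have hgeom_le : (1 - r)⁻¹ ≤ 1 + 2 * r := by
    rw [inv_le_iff_one_le_mul₀ (by linarith)]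
    nlinarith
  have harith_le : r / (1 - r) ^ 2 ≤ 2 := by
    rw [div_le_iff₀ (by nlinarith)]
    nlinarith
  calc ∑ j ∈ s, (n + 2 * j) * r ^ j = n * ∑ j ∈ s, r ^ j + 2 * ∑ j ∈ s, j * r ^ j := by
        rw [mul_sum, mul_sum, ← sum_add_distrib]
        exact sum_congr rfl fun j _ => by ring
    _ ≤ n * (1 - r)⁻¹ + 2 * (r / (1 - r) ^ 2) := by
        gcongr
        · exact sum_le_hasSum s (fun _ _ => by positivity) hgeom
        · exact sum_le_hasSum s (fun _ _ => by positivity) harith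
    _ ≤ n * (1 + 2 * r) + 2 * 2 := by gcongr
    _ = n * (1 + 2 * r) + 4 := by norm_num

theorem sum_pow_div_factorial_add_two_mul_le {L : ℝ} (hL : 0 ≤ L) (n : ℕ) (s : Finset ℕ) :
    ∑ j ∈ s, L ^ (n + 2 * j) / (n + 2 * j).factorial ≤ L ^ n / n.factorial * Real.exp L := by
  have hterm (j : ℕ) : L ^ (n + 2 * j) / (n + 2 * j).factorial ≤
      L ^ n / n.factorial * (L ^ (2 * j) / (2 * j).factorial) := by
    rw [div_mul_div_comm, ← pow_add]
    gcongr
    exact_mod_cast Nat.le_of_dvd (Nat.factorial_pos _)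
      (Nat.factorial_mul_factorial_dvd_factorial_add n (2 * j))
  calc ∑ j ∈ s, L ^ (n + 2 * j) / (n + 2 * j).factorial
      ≤ L ^ n / n.factorial * ∑ i ∈ s.image (2 * ·), L ^ i / i.factorial := by
        rw [sum_image fun a _ b _ h => by simpa using h, mul_sum]
        exact sum_le_sum fun j _ => hterm j
    _ ≤ L ^ n / n.factorial * Real.exp L := by
        gcongr
        rw [Real.exp_eq_exp_ℝ]
        exact sum_le_hasSum _ (fun _ _ => by positivity)
          (NormedSpace.expSeries_div_hasSum_exp (𝔸 := ℝ) L)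

end PrimeBlocks

section FriableSquarefree

theorem squarefree_prod_primes {S : Finset ℕ} (hS : ∀ p ∈ S, p.Prime) :
    Squarefree (∏ p ∈ S, p) :=
  Finset.squarefree_prod_of_pairwise_isCoprime
    (fun p hp q hq hpq => Nat.coprime_iff_isRelPrime.1
      ((Nat.coprime_primes (hS p hp) (hS q hq)).2 hpq))
    fun p hp => (hS p hp).prime.squarefree

theorem two_pow_cardDistinctFactors_mul_moebius_sq_prod {S : Finset ℕ} (hS : ∀ p ∈ S, p.Prime) :
    (2 : ℝ) ^ ArithmeticFunction.cardDistinctFactors (∏ p ∈ S, p) *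
      (ArithmeticFunction.moebius (∏ p ∈ S, p) : ℝ) ^ 2 = 2 ^ #S := by
  have hmoebius : (ArithmeticFunction.moebius (∏ p ∈ S, p) : ℝ) ^ 2 = 1 := by
    exact_mod_cast
      ArithmeticFunction.moebius_sq_eq_one_of_squarefree (squarefree_prod_primes hS)
  rw [hmoebius, mul_one, ArithmeticFunction.cardDistinctFactors_apply, ← List.card_toFinset]
  congr 2
  exact Nat.primeFactors_prod hS

theorem sum_two_pow_card_le_friableOmegaSum {y : ℕ} {x : ℝ} {𝒮 : Finset (Finset ℕ)}
    (hsub : ∀ S ∈ 𝒮, S ⊆ y.primesLE) (hle : ∀ S ∈ 𝒮, ((∏ p ∈ S, p : ℕ) : ℝ) ≤ x) :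
    ∑ S ∈ 𝒮, (2 : ℝ) ^ #S ≤ friableOmegaSum x y := by
  have hprime (S) (hS : S ∈ 𝒮) : ∀ p ∈ S, p.Prime := fun p hp =>
    Nat.prime_of_mem_primesLE (hsub S hS hp)
  have hinj : Set.InjOn (fun S : Finset ℕ => ∏ p ∈ S, p) 𝒮 := fun S hS T hT h => by
    rw [← Nat.primeFactors_prod (hprime S hS), ← Nat.primeFactors_prod (hprime T hT)]
    exact congrArg Nat.primeFactors h
  rw [friableOmegaSum, sum_congr rfl fun S hS =>
    (two_pow_cardDistinctFactors_mul_moebius_sq_prod (hprime S hS)).symm, ← sum_image hinj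
    (f := fun n => (2 : ℝ) ^ ArithmeticFunction.cardDistinctFactors n *
      (ArithmeticFunction.moebius n : ℝ) ^ 2)]
  refine sum_le_sum_of_subset_of_nonneg (image_subset_iff.2 fun S hS => ?_)
    fun _ _ _ => by positivity
  rw [mem_filter, mem_Icc, Nat.primeFactors_prod (hprime S hS)]
  exact ⟨⟨Nat.one_le_iff_ne_zero.2 (squarefree_prod_primes (hprime S hS)).ne_zero,
    Nat.le_floor (hle S hS)⟩, fun p hp => Nat.le_of_mem_primesLE (hsub S hS hp)⟩

theorem friableOmegaSum_nonneg (x : ℝ) (y : ℕ) : 0 ≤ friableOmegaSum x y :=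
  sum_nonneg fun _ _ => by positivity

theorem friableOmegaSum_mono {x x' : ℝ} {y y' : ℕ} (hx : x ≤ x') (hy : y ≤ y') :
    friableOmegaSum x y ≤ friableOmegaSum x' y' := by
  refine sum_le_sum_of_subset_of_nonneg (fun n hn => ?_) fun _ _ _ => by positivity
  rw [mem_filter, mem_Icc] at hn ⊢
  exact ⟨⟨hn.1.1, hn.1.2.trans (Nat.floor_mono hx)⟩, fun p hp => (hn.2 p hp).trans hy⟩

end FriableSquarefree

section TwoDimensionalSieve

theorem prod_le_rpow_of_card_primeBlock_le {y k n : ℕ} {u : ℝ} (hy : 1 ≤ y) (hk : 1 ≤ k)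
    (hu : n * (1 + 2 / 2 ^ k) + 4 ≤ u) {S : Finset ℕ} (hS : S ⊆ y.primesLE)
    (hcard : ∀ j ∈ S.image (primeBlock y (2 ^ k)),
      #{p ∈ S | primeBlock y (2 ^ k) p = j} ≤ n + 2 * j) :
    ((∏ p ∈ S, p : ℕ) : ℝ) ≤ (y : ℝ) ^ u := by
  set J := primeBlock y (2 ^ k)
  have hprime : ∀ p ∈ S, p.Prime := fun p hp => Nat.prime_of_mem_primesLE (hS hp)
  have : 0 ≤ Real.log y := Real.log_natCast_nonneg y
  have hhalf : (1 : ℝ) / 2 ^ k ≤ 1 / 2 := by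
    gcongr
    exact le_self_pow₀ one_le_two (by omega)
  rw [Real.le_rpow_iff_log_le (by exact_mod_cast prod_pos fun p hp => (hprime p hp).pos)
    (by exact_mod_cast hy)]
  push_cast
  rw [Real.log_prod fun p hp => by exact_mod_cast (hprime p hp).ne_zero]
  calc ∑ p ∈ S, Real.log p ≤ ∑ p ∈ S, (1 / 2 ^ k) ^ J p * Real.log y := by
        refine sum_le_sum fun p hp => ?_
        simpa using log_le_of_primeBlock (K := 2 ^ k) (by positivity) (hprime p hp).one_lt
          (Nat.le_of_mem_primesLE (hS hp))
    _ = (∑ j ∈ S.image J, #{p ∈ S | J p = j} * (1 / 2 ^ k : ℝ) ^ j) * Real.log y := by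
        rw [← sum_mul, sum_comp (fun j => (1 / 2 ^ k : ℝ) ^ j) J]
        simp only [nsmul_eq_mul]
    _ ≤ (∑ j ∈ S.image J, (n + 2 * j) * (1 / 2 ^ k : ℝ) ^ j) * Real.log y := by
        gcongr with j hj
        exact_mod_cast hcard j hj
    _ ≤ (n * (1 + 2 * (1 / 2 ^ k)) + 4) * Real.log y := by
        gcongr
        exact sum_add_two_mul_mul_pow_le (Nat.cast_nonneg n) (by positivity) hhalf _
    _ ≤ u * Real.log y := by
        gcongr
        rwa [mul_one_div]

/-- The number of `m < X` outside the residue classes `Ω p` modulo `p` for all primes `p ≤ y`. -/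
def sievedCount (Ω : ∀ p : ℕ, Finset (ZMod p)) (y X : ℕ) : ℕ :=
  #{m ∈ range X | ∀ p ∈ y.primesLE, ((m : ℕ) : ZMod p) ∉ Ω p}

/-- The density of the integers outside the residue classes `Ω p` for all primes `p ≤ y`. -/
noncomputable def sievedDensity (Ω : ∀ p : ℕ, Finset (ZMod p)) (y : ℕ) : ℝ :=
  ∏ p ∈ y.primesLE, (1 - (#(Ω p) : ℝ) / p)

/-- The sieving condition of dimension two: at most two classes are removed modulo each prime, and
never all of them. -/
def IsTwoDimensionalSieve (Ω : ∀ p : ℕ, Finset (ZMod p)) : Prop :=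
  ∀ p, p.Prime → #(Ω p) ≤ 2 ∧ #(Ω p) < p

/-- A bound for the relative error of the sieve whose blocks are cut at `y ^ (1 / 2 ^ (k * j))` and
whose `j`-th block is truncated at `n + 2 * j` primes. -/
noncomputable def sieveError (k n : ℕ) : ℝ :=
  Real.exp (96 * k) * ((24 * k : ℝ) ^ n / n.factorial)

variable {Ω : ∀ p : ℕ, Finset (ZMod p)}

namespace IsTwoDimensionalSieve

theorem card_div_mem_Icc (hΩ : IsTwoDimensionalSieve Ω) {p : ℕ} (hp : p.Prime) :
    (#(Ω p) : ℝ) / p ∈ Set.Icc 0 1 :=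
  ⟨by positivity, div_le_one_of_le₀ (by exact_mod_cast (hΩ p hp).2.le) (by positivity)⟩

theorem sievedDensity_pos (hΩ : IsTwoDimensionalSieve Ω) (y : ℕ) : 0 < sievedDensity Ω y :=
  prod_pos fun p hp => by
    have hprime := Nat.prime_of_mem_primesLE hp
    rw [sub_pos, div_lt_one (by exact_mod_cast hprime.pos)]
    exact_mod_cast (hΩ p hprime).2

theorem sum_powersetCard_primeBlock_le (hΩ : IsTwoDimensionalSieve Ω) {y k : ℕ} (hk : 1 ≤ k)
    (j n : ℕ) :
    ∑ S ∈ {p ∈ y.primesLE | primeBlock y (2 ^ k) p = j}.powersetCard n,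
        ∏ p ∈ S, (#(Ω p) : ℝ) / p ≤
      Real.exp (72 * k) * ((24 * k : ℝ) ^ n / n.factorial) *
        ∏ p ∈ y.primesLE with primeBlock y (2 ^ k) p = j, (1 - (#(Ω p) : ℝ) / p) := by
  set A := {p ∈ y.primesLE | primeBlock y (2 ^ k) p = j}
  have hprime : ∀ p ∈ A, p.Prime := fun p hp => Nat.prime_of_mem_primesLE (mem_filter.1 hp).1
  have hblock : ∑ p ∈ A, (1 : ℝ) / p ≤ 12 * k := sum_inv_primeBlock_le hk j
  have hsum : ∑ p ∈ A, (#(Ω p) : ℝ) / p ≤ 24 * k := by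
    calc ∑ p ∈ A, (#(Ω p) : ℝ) / p ≤ ∑ p ∈ A, 2 * ((1 : ℝ) / p) := by
          refine sum_le_sum fun p hp => ?_
          rw [mul_one_div]
          gcongr
          exact_mod_cast (hΩ p (hprime p hp)).1
      _ ≤ 24 * k := by rw [← mul_sum]; linarith
  have hprod : Real.exp (-(72 * k)) ≤ ∏ p ∈ A, (1 - (#(Ω p) : ℝ) / p) :=
    (Real.exp_le_exp.2 (by linarith)).trans
      (exp_neg_six_mul_sum_inv_le_prod fun p hp => hΩ p (hprime p hp))
  calc ∑ S ∈ A.powersetCard n, ∏ p ∈ S, (#(Ω p) : ℝ) / p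
      ≤ (∑ p ∈ A, (#(Ω p) : ℝ) / p) ^ n / n.factorial :=
        sum_powersetCard_prod_le_pow_div_factorial (fun _ _ => by positivity) n
    _ ≤ (24 * k : ℝ) ^ n / n.factorial := by
        have hsum_nonneg : 0 ≤ ∑ p ∈ A, (#(Ω p) : ℝ) / p := sum_nonneg fun _ _ => by positivity
        exact div_le_div_of_nonneg_right (pow_le_pow_left₀ hsum_nonneg hsum n) (by positivity)
    _ = Real.exp (72 * k) * ((24 * k : ℝ) ^ n / n.factorial) * Real.exp (-(72 * k)) := by
        rw [mul_right_comm, ← Real.exp_add, add_neg_cancel, Real.exp_zero, one_mul]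
    _ ≤ _ := mul_le_mul_of_nonneg_left hprod (by positivity)

theorem sieveGap_primeBlock_le (hΩ : IsTwoDimensionalSieve Ω) {k n : ℕ} (hk : 1 ≤ k) (hn : Odd n)
    (y : ℕ) :
    sieveGap y.primesLE (primeBlock y (2 ^ k)) (fun j => n + 2 * j) (fun p => (#(Ω p) : ℝ) / p) ≤
      sievedDensity Ω y * (sieveError k n * Real.exp (sieveError k n)) := by
  have hgap := sieveGap_le (A := y.primesLE) (J := primeBlock y (2 ^ k)) (n := fun j => n + 2 * j)
    (x := fun p => (#(Ω p) : ℝ) / p)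
    (fun p hp => hΩ.card_div_mem_Icc (Nat.prime_of_mem_primesLE hp))
    (fun j => hn.add_even (even_two_mul j)) (fun _ _ => by positivity)
    fun j _ => hΩ.sum_powersetCard_primeBlock_le hk j (n + 2 * j)
  set δ := ∑ j ∈ y.primesLE.image (primeBlock y (2 ^ k)),
    Real.exp (72 * k) * ((24 * k : ℝ) ^ (n + 2 * j) / (n + 2 * j).factorial) with hδ
  have hδ_nonneg : 0 ≤ δ := by positivity
  have hδ_le : δ ≤ sieveError k n := by
    calc δ ≤ Real.exp (72 * k) * ((24 * k : ℝ) ^ n / n.factorial * Real.exp (24 * k)) := by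
          rw [hδ, ← mul_sum]
          gcongr
          exact sum_pow_div_factorial_add_two_mul_le (by positivity) n _
      _ = sieveError k n := by
          rw [sieveError, show (96 * k : ℝ) = 72 * k + 24 * k by ring, Real.exp_add]
          ring
  refine hgap.trans (mul_le_mul_of_nonneg_left ?_ (hΩ.sievedDensity_pos y).le)
  exact mul_le_mul hδ_le (Real.exp_le_exp.2 hδ_le) (Real.exp_pos δ).le (hδ_nonneg.trans hδ_le)

theorem abs_sievedCount_sub_le (hΩ : IsTwoDimensionalSieve Ω) {y k n : ℕ} {u : ℝ} (hy : 1 ≤ y)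
    (hk : 1 ≤ k) (hn : Odd n) (hu : n * (1 + 2 / 2 ^ k) + 4 ≤ u) (X : ℕ) :
    |sievedCount Ω y X - X * sievedDensity Ω y| ≤
      X * (sievedDensity Ω y * (sieveError k n * Real.exp (sieveError k n))) +
        friableOmegaSum ((y : ℝ) ^ u) y := by
  have hsieve := abs_sum_prod_one_sub_sub_le (A := y.primesLE) (J := primeBlock y (2 ^ k))
    (n := fun j => n + 2 * j) (B := range X) (Nat.cast_nonneg X)
    (x := fun p m => if (m : ZMod p) ∈ Ω p then (1 : ℝ) else 0)
    (fun p _ m _ => by split_ifs <;> simp) (ρ := fun p => (#(Ω p) : ℝ) / p)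
    (fun p hp => hΩ.card_div_mem_Icc (Nat.prime_of_mem_primesLE hp))
    (fun j => hn.add_even (even_two_mul j)) (E := fun S => 2 ^ #S) fun S hS => by
      have hprime : ∀ p ∈ S, p.Prime := fun p hp =>
        Nat.prime_of_mem_primesLE (subset_of_mem_lowerSieveSets hS hp)
      simp only [prod_boole, sum_boole]
      exact (abs_card_filter_forall_cast_mem_sub_le Ω hprime X).trans
        ((prod_le_prod (fun _ _ => Nat.cast_nonneg _) fun p hp =>
          (by exact_mod_cast (hΩ p (hprime p hp)).1 : _ ≤ (2 : ℝ))).trans_eq (prod_const 2))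
  have hcount : ∑ m ∈ range X, ∏ p ∈ y.primesLE, (1 - if (m : ZMod p) ∈ Ω p then (1 : ℝ) else 0) =
      sievedCount Ω y X := by
    rw [sievedCount, ← sum_boole]
    refine sum_congr rfl fun m _ => ?_
    rw [← prod_boole]
    refine prod_congr rfl fun p _ => ?_
    split_ifs <;> norm_num
  rw [hcount] at hsieve
  refine hsieve.trans (add_le_add ?_ ?_)
  · exact mul_le_mul_of_nonneg_left (hΩ.sieveGap_primeBlock_le hk hn y) (Nat.cast_nonneg X)
  · refine sum_two_pow_card_le_friableOmegaSum (fun S hS => subset_of_mem_lowerSieveSets hS)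
      fun S hS => prod_le_rpow_of_card_primeBlock_le hy hk hu (subset_of_mem_lowerSieveSets hS)
        fun j hj => card_filter_le_of_mem_lowerSieveSets hS ?_
    exact image_subset_image (subset_of_mem_lowerSieveSets hS) hj

end IsTwoDimensionalSieve

end TwoDimensionalSieve

section SieveParameters

theorem exists_odd_natCast_mem_Icc {v : ℝ} (hv : 1 ≤ v) :
    ∃ n : ℕ, Odd n ∧ (n : ℝ) ∈ Set.Icc (v - 2) v := by
  have hfloor : 1 ≤ ⌊v⌋₊ := Nat.le_floor (by exact_mod_cast hv)
  have hle : (⌊v⌋₊ : ℝ) ≤ v := Nat.floor_le (by linarith)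
  have hlt : v < ⌊v⌋₊ + 1 := Nat.lt_floor_add_one v
  rcases Nat.even_or_odd ⌊v⌋₊ with heven | hodd
  · refine ⟨⌊v⌋₊ - 1, Nat.Even.sub_odd hfloor heven odd_one, ?_⟩
    rw [Nat.cast_sub hfloor, Nat.cast_one]
    constructor <;> linarith
  · exact ⟨⌊v⌋₊, hodd, by linarith, hle⟩

theorem pow_div_factorial_le_pow {a v : ℝ} (ha : 0 ≤ a) (hv : 0 < v) {n : ℕ} (hvn : v ≤ n) :
    a ^ n / n.factorial ≤ (Real.exp 1 * a / v) ^ n := by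
  have hpow : v ^ n ≤ Real.exp 1 ^ n * n.factorial := by
    rw [← div_le_iff₀ (by positivity), ← Real.exp_nat_mul, mul_one]
    refine le_trans ?_ (Real.pow_div_factorial_le_exp n (Nat.cast_nonneg n) n)
    gcongr
  rw [div_pow, mul_pow, div_le_div_iff₀ (by positivity) (by positivity)]
  calc a ^ n * v ^ n ≤ a ^ n * (Real.exp 1 ^ n * n.factorial) := by gcongr
    _ = Real.exp 1 ^ n * a ^ n * n.factorial := by ring

theorem eventually_sieveError_le {δ : ℝ} (hδ0 : 0 < δ) (hδ1 : δ < 1) {k : ℕ} (hk : 1 ≤ k) :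
    ∀ᶠ u : ℝ in Filter.atTop, ∀ n : ℕ, (1 - δ / 2) * u ≤ n →
      sieveError k n ≤ u ^ (-(u * (1 - δ))) := by
  set B : ℝ := 48 * k * Real.exp 1 with hB
  have hB1 : 1 ≤ B := by
    have hk' : (1 : ℝ) ≤ k := by exact_mod_cast hk
    nlinarith [Real.one_le_exp zero_le_one]
  filter_upwards [Filter.eventually_ge_atTop B,
    (tendsto_rpow_atTop (half_pos hδ0)).eventually_ge_atTop (Real.exp (96 * k) * B)]
    with u huB hu n hn
  have hu1 : 1 ≤ u := hB1.trans huB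
  have hu0 : 0 < u := by linarith
  set v := (1 - δ / 2) * u with hv
  have hfactorial : (24 * k : ℝ) ^ n / n.factorial ≤ (B / u) ^ n := by
    refine (pow_div_factorial_le_pow (v := u / 2) (by positivity) (by positivity)
      (by nlinarith)).trans_eq ?_
    rw [hB]
    congr 1
    field_simp
    norm_num
  calc sieveError k n ≤ Real.exp (96 * k) * (B / u) ^ v := by
        rw [sieveError]
        gcongr
        refine hfactorial.trans ?_
        rw [← Real.rpow_natCast]
        exact Real.rpow_le_rpow_of_exponent_ge (by positivity) ((div_le_one hu0).2 huB) hn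
    _ = Real.exp (96 * k) ^ (1 : ℝ) * B ^ v * u ^ (-v) := by
        rw [Real.div_rpow (by positivity) hu0.le, Real.rpow_neg hu0.le, Real.rpow_one]
        ring
    _ ≤ Real.exp (96 * k) ^ u * B ^ u * u ^ (-v) := by
        gcongr
        · exact Real.one_le_exp (by positivity)
        · nlinarith
    _ = (Real.exp (96 * k) * B) ^ u * u ^ (-v) := by
        rw [Real.mul_rpow (Real.exp_pos _).le (zero_le_one.trans hB1)]
    _ ≤ (u ^ (δ / 2)) ^ u * u ^ (-v) := by gcongr
    _ = u ^ (-(u * (1 - δ))) := by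
        rw [← Real.rpow_mul hu0.le, ← Real.rpow_add hu0, hv]
        ring_nf

theorem exists_sieve_parameters {δ : ℝ} (hδ0 : 0 < δ) (hδ1 : δ < 1) :
    ∃ k : ℕ, 1 ≤ k ∧ ∀ᶠ u : ℝ in Filter.atTop, ∃ n : ℕ, Odd n ∧
      n * (1 + 2 / 2 ^ k) + 4 ≤ u ∧ sieveError k n ≤ u ^ (-(u * (1 - δ))) := by
  obtain ⟨k, hk⟩ := exists_pow_lt_of_lt_one (show 0 < δ / 8 by positivity) one_half_lt_one
  have hk1 : 1 ≤ k := by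
    by_contra! h
    rw [Nat.lt_one_iff.1 h, pow_zero] at hk
    linarith
  refine ⟨k, hk1, ?_⟩
  set r : ℝ := 2 / 2 ^ k with hr
  have hr0 : 0 ≤ r := by positivity
  have hrδ : r ≤ δ / 4 := by
    rw [hr, ← mul_one_div, ← one_div_pow]
    linarith
  filter_upwards [eventually_sieveError_le hδ0 hδ1 hk1, Filter.eventually_ge_atTop (24 / δ)]
    with u herror hu
  have huδ : 24 ≤ δ * u := by rwa [div_le_iff₀' hδ0] at hu
  have hu24 : 24 ≤ u := by nlinarith
  have hv : (u - 4) * (1 - δ / 4) ≤ (u - 4) / (1 + r) := by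
    rw [le_div_iff₀ (by linarith), mul_assoc]
    exact mul_le_of_le_one_right (by linarith) (by nlinarith)
  obtain ⟨n, hodd, hge, hle⟩ := exists_odd_natCast_mem_Icc (v := (u - 4) / (1 + r)) (by nlinarith)
  refine ⟨n, hodd, ?_, herror n (by nlinarith)⟩
  rw [le_div_iff₀ (by linarith)] at hle
  linarith

end SieveParameters

section FundamentalLemma

/-- The conclusion of the fundamental lemma for sieves of dimension two, at level `y ^ u`, with
constant `C` and relative error `u ^ (-u * (1 - δ))`. -/
def FundamentalLemmaAt (C u δ : ℝ) : Prop :=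
  ∀ Ω : ∀ p : ℕ, Finset (ZMod p), IsTwoDimensionalSieve Ω → ∀ y X : ℕ, 1 ≤ y →
    |sievedCount Ω y X - X * sievedDensity Ω y| ≤
      C * (X * (sievedDensity Ω y * u ^ (-(u * (1 - δ)))) + friableOmegaSum ((y : ℝ) ^ u) y)

theorem FundamentalLemmaAt.mono {C C' u δ : ℝ} (hu : 0 ≤ u) (h : FundamentalLemmaAt C u δ)
    (hC : C ≤ C') : FundamentalLemmaAt C' u δ := fun Ω hΩ y X hy =>
  (h Ω hΩ y X hy).trans <| mul_le_mul_of_nonneg_right hC <| add_nonneg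
    (mul_nonneg (Nat.cast_nonneg X) (mul_nonneg (hΩ.sievedDensity_pos y).le
      (Real.rpow_nonneg hu _))) (friableOmegaSum_nonneg _ _)

theorem eventually_fundamentalLemmaAt {δ : ℝ} (hδ0 : 0 < δ) (hδ1 : δ < 1) :
    ∀ᶠ u : ℝ in Filter.atTop, FundamentalLemmaAt 3 u δ := by
  obtain ⟨k, hk, h⟩ := exists_sieve_parameters hδ0 hδ1
  filter_upwards [h, Filter.eventually_ge_atTop 1] with u ⟨n, hodd, hn, herror⟩ hu Ω hΩ y X hy
  have hsieve := hΩ.abs_sievedCount_sub_le hy hk hodd hn X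
  have hW := (hΩ.sievedDensity_pos y).le
  have hψ := friableOmegaSum_nonneg ((y : ℝ) ^ u) y
  have : 0 ≤ sieveError k n := by
    rw [sieveError]
    positivity
  have herror_le_one : sieveError k n ≤ 1 :=
    herror.trans (Real.rpow_le_one_of_one_le_of_nonpos hu (by nlinarith))
  have hexp : Real.exp (sieveError k n) ≤ 3 :=
    (Real.exp_le_exp.2 herror_le_one).trans Real.exp_one_lt_three.le
  calc |sievedCount Ω y X - X * sievedDensity Ω y|
      ≤ X * (sievedDensity Ω y * (u ^ (-(u * (1 - δ))) * 3)) +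
          friableOmegaSum ((y : ℝ) ^ u) y := hsieve.trans (by gcongr)
    _ ≤ _ := by linarith

theorem sievedCount_anti (Ω : ∀ p : ℕ, Finset (ZMod p)) {y z : ℕ} (hzy : z ≤ y) (X : ℕ) :
    sievedCount Ω y X ≤ sievedCount Ω z X :=
  card_le_card (monotone_filter_right _ fun _ _ h p hp => h p (Nat.primesLE_mono hzy hp))

theorem sievedDensity_le_exp_mul {Ω : ∀ p : ℕ, Finset (ZMod p)} (hΩ : IsTwoDimensionalSieve Ω)
    {y z a : ℕ} (hz : 1 ≤ z) (hzy : z ≤ y) (hy : y < (z + 1) ^ 2 ^ a) :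
    sievedDensity Ω z ≤ Real.exp (72 * a) * sievedDensity Ω y := by
  set A := y.primesLE \ z.primesLE
  have hA (p) (hp : p ∈ A) : p.Prime ∧ z < p ∧ p ≤ y := by
    simp only [A, mem_sdiff, Nat.mem_primesLE, not_and] at hp
    exact ⟨hp.1.2, not_le.1 fun h => hp.2 h hp.1.2, hp.1.1⟩
  have hsum : ∑ p ∈ A, (1 : ℝ) / p ≤ 12 * a :=
    sum_inv_primes_le_of_lt_pow (x := z + 1) (by omega) a (fun p hp => (hA p hp).1)
      (fun p hp => (hA p hp).2.1) fun p hp => (hA p hp).2.2.trans_lt hy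
  have hprod : Real.exp (-(72 * a)) ≤ ∏ p ∈ A, (1 - (#(Ω p) : ℝ) / p) :=
    (Real.exp_le_exp.2 (by linarith)).trans
      (exp_neg_six_mul_sum_inv_le_prod fun p hp => hΩ p (hA p hp).1)
  have hW := (hΩ.sievedDensity_pos z).le
  calc sievedDensity Ω z
      = Real.exp (72 * a) * (Real.exp (-(72 * a)) * sievedDensity Ω z) := by
        rw [← mul_assoc, ← Real.exp_add, add_neg_cancel, Real.exp_zero, one_mul]
    _ ≤ Real.exp (72 * a) * ((∏ p ∈ A, (1 - (#(Ω p) : ℝ) / p)) * sievedDensity Ω z) := by gcongr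
    _ = Real.exp (72 * a) * sievedDensity Ω y := by
        rw [sievedDensity, sievedDensity, prod_sdiff (Nat.primesLE_mono hzy)]

-- For bounded `u` one sieves only by the primes up to `z = y ^ (1 / 2 ^ a)`, for which the level
-- `y` is a large power of `z`; this costs only a constant factor in the density.
theorem exists_sievedCount_le_mul : ∃ C : ℝ, 0 < C ∧ ∀ u : ℝ, 1 ≤ u →
    ∀ Ω : ∀ p : ℕ, Finset (ZMod p), IsTwoDimensionalSieve Ω → ∀ y X : ℕ, 1 ≤ y →
      (sievedCount Ω y X : ℝ) ≤
        C * (X * sievedDensity Ω y + friableOmegaSum ((y : ℝ) ^ u) y) := by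
  obtain ⟨a, ha⟩ := ((tendsto_pow_atTop_atTop_of_one_lt (one_lt_two (α := ℝ))).eventually
    (eventually_fundamentalLemmaAt (δ := 1 / 2) (by norm_num) (by norm_num))).exists
  refine ⟨4 * Real.exp (72 * a), by positivity, fun u hu Ω hΩ y X hy => ?_⟩
  set z := Nat.nthRoot (2 ^ a) y
  have hzpow : z ^ 2 ^ a ≤ y := Nat.pow_nthRoot_le (.inl (by positivity))
  have hlt : y < (z + 1) ^ 2 ^ a := Nat.lt_pow_nthRoot_add_one (by positivity) y
  have hz1 : 1 ≤ z := by
    by_contra! h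
    rw [Nat.lt_one_iff.1 h, zero_add, one_pow] at hlt
    omega
  have hzy : z ≤ y := (Nat.le_self_pow (by positivity) z).trans hzpow
  have hψ : friableOmegaSum ((z : ℝ) ^ (2 ^ a : ℝ)) z ≤ friableOmegaSum ((y : ℝ) ^ u) y := by
    refine friableOmegaSum_mono ?_ hzy
    calc (z : ℝ) ^ (2 ^ a : ℝ) = (z ^ 2 ^ a : ℕ) := by
          rw [← Nat.cast_ofNat (R := ℝ), ← Nat.cast_pow, Real.rpow_natCast, Nat.cast_pow]
      _ ≤ y := by exact_mod_cast hzpow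
      _ ≤ (y : ℝ) ^ u := Real.self_le_rpow_of_one_le (by exact_mod_cast hy) hu
  have hWz := (hΩ.sievedDensity_pos z).le
  have hW := sievedDensity_le_exp_mul hΩ hz1 hzy hlt
  have hη : ((2 : ℝ) ^ a) ^ (-((2 : ℝ) ^ a * (1 - 1 / 2))) ≤ 1 :=
    Real.rpow_le_one_of_one_le_of_nonpos (one_le_pow₀ one_le_two)
      (by linarith [pow_pos (two_pos (α := ℝ)) a])
  have hfl := (abs_le.1 (ha Ω hΩ z X hz1)).2
  calc (sievedCount Ω y X : ℝ) ≤ sievedCount Ω z X := by exact_mod_cast sievedCount_anti Ω hzy X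
    _ ≤ X * sievedDensity Ω z + 3 * (X * (sievedDensity Ω z * 1) +
          friableOmegaSum ((y : ℝ) ^ u) y) := (sub_le_iff_le_add'.1 hfl).trans (by gcongr)
    _ ≤ 4 * (X * sievedDensity Ω z) + 4 * (1 * friableOmegaSum ((y : ℝ) ^ u) y) := by
        linarith [friableOmegaSum_nonneg ((y : ℝ) ^ u) y]
    _ ≤ 4 * (X * (Real.exp (72 * a) * sievedDensity Ω y)) +
          4 * (Real.exp (72 * a) * friableOmegaSum ((y : ℝ) ^ u) y) := by
        gcongr
        · exact friableOmegaSum_nonneg _ _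
        · exact Real.one_le_exp (by positivity)
    _ = _ := by ring

theorem exists_forall_fundamentalLemmaAt_one :
    ∃ C : ℝ, 0 < C ∧ ∀ u, 1 ≤ u → FundamentalLemmaAt C u 1 := by
  obtain ⟨C, hC, h⟩ := exists_sievedCount_le_mul
  refine ⟨C + 1, by linarith, fun u hu Ω hΩ y X hy => ?_⟩
  have hcount := h u hu Ω hΩ y X hy
  have hψ := friableOmegaSum_nonneg ((y : ℝ) ^ u) y
  have : (0 : ℝ) ≤ sievedCount Ω y X := Nat.cast_nonneg _
  have hXW : 0 ≤ X * sievedDensity Ω y :=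
    mul_nonneg (Nat.cast_nonneg X) (hΩ.sievedDensity_pos y).le
  rw [sub_self, mul_zero, neg_zero, Real.rpow_zero, mul_one, abs_le]
  constructor <;> nlinarith

theorem exists_tendsto_zero_of_eventually {Q : ℝ → ℝ → Prop} {u₀ : ℝ} (h1 : ∀ u, u₀ ≤ u → Q u 1)
    (h : ∀ δ : ℝ, 0 < δ → δ < 1 → ∀ᶠ u in Filter.atTop, Q u δ) :
    ∃ δ : ℝ → ℝ, (∀ u, δ u ∈ Set.Icc 0 1) ∧ Filter.Tendsto δ Filter.atTop (nhds 0) ∧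
      ∀ u, u₀ ≤ u → Q u (δ u) := by
  let D (u : ℝ) : Set ℝ := {δ | δ ∈ Set.Icc 0 1 ∧ (u₀ ≤ u → Q u δ)}
  have hbdd (u) : BddBelow (D u) := ⟨0, fun _ hδ => hδ.1.1⟩
  have hnear (u) : ∃ δ ∈ D u, δ < sInf (D u) + Real.exp (-u) :=
    exists_lt_of_csInf_lt ⟨1, ⟨zero_le_one, le_rfl⟩, h1 u⟩
      (lt_add_of_pos_right _ (Real.exp_pos _))
  choose δ hδD hδ using hnear
  refine ⟨δ, fun u => (hδD u).1, ?_, fun u => (hδD u).2⟩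
  refine tendsto_order.2 ⟨fun e he => .of_forall fun u => he.trans_le (hδD u).1.1, fun e he => ?_⟩
  obtain ⟨d, hd0, hd⟩ := exists_between (show 0 < min (e / 2) 1 by positivity)
  rw [lt_min_iff] at hd
  filter_upwards [h d hd0 hd.2,
    Real.tendsto_exp_neg_atTop_nhds_zero.eventually_lt_const (half_pos he)] with u hQ hexp
  linarith [hδ u, csInf_le (hbdd u) ⟨⟨hd0.le, hd.2.le⟩, fun _ => hQ⟩]

theorem exists_fundamentalLemmaAt : ∃ C : ℝ, 0 < C ∧ ∃ δ : ℝ → ℝ, (∀ u, δ u ∈ Set.Icc 0 1) ∧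
    Filter.Tendsto δ Filter.atTop (nhds 0) ∧ ∀ u, 1 ≤ u → FundamentalLemmaAt C u (δ u) := by
  obtain ⟨C, hC, h⟩ := exists_forall_fundamentalLemmaAt_one
  refine ⟨C + 3, by linarith, exists_tendsto_zero_of_eventually
    (fun u hu => (h u hu).mono (by linarith) (by linarith)) fun δ hδ0 hδ1 => ?_⟩
  filter_upwards [eventually_fundamentalLemmaAt hδ0 hδ1, Filter.eventually_ge_atTop 0] with u hfl hu
  exact hfl.mono hu (by linarith)

end FundamentalLemma

section Pairs

theorem siftedDensity_eq_prod_primesLE (y : ℕ) :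
    siftedDensity y = ∏ p ∈ y.primesLE, (1 - 1 / (p : ℝ)) := by
  rw [siftedDensity, Nat.primesLE_eq_filter_Icc_one]

theorem one_sub_one_div_prime_nonneg {p : ℕ} (hp : p.Prime) : 0 ≤ 1 - 1 / (p : ℝ) :=
  sub_nonneg.2 <| (div_le_one₀ (by exact_mod_cast hp.pos)).2 (by exact_mod_cast hp.one_le)

theorem siftedDensity_nonneg (y : ℕ) : 0 ≤ siftedDensity y := by
  rw [siftedDensity_eq_prod_primesLE]
  exact prod_nonneg fun p hp => one_sub_one_div_prime_nonneg (Nat.prime_of_mem_primesLE hp)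

theorem siftedDensity_le_one (y : ℕ) : siftedDensity y ≤ 1 := by
  rw [siftedDensity_eq_prod_primesLE]
  exact prod_le_one (fun p hp => one_sub_one_div_prime_nonneg (Nat.prime_of_mem_primesLE hp))
    fun p _ => sub_le_self 1 (by positivity)

theorem alphaSifted_eq_ite (y n : ℕ) :
    alphaSifted y n = if ∀ p ∈ y.primesLE, ¬ p ∣ n then 1 else 0 := by
  classical
  refine if_congr ?_ rfl rfl
  simp only [Nat.mem_primesLE, ← not_le]
  exact ⟨fun h p hp hd => h p hp.2 hd hp.1, fun h p hp hd hy => h p ⟨hy, hp⟩ hd⟩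

theorem alphaSifted_mul_self (y n : ℕ) : alphaSifted y n * alphaSifted y n = alphaSifted y n := by
  unfold alphaSifted
  split_ifs <;> simp

/-- The residues modulo `p` of the `m` such that `p` divides `m + i` or `m + j`. -/
def pairResidues (i j p : ℕ) : Finset (ZMod p) := {-(i : ZMod p), -(j : ZMod p)}

/-- The density of the `m` such that neither `m + i` nor `m + j` has a prime factor `≤ y`. -/
noncomputable def pairDensity (y i j : ℕ) : ℝ := sievedDensity (pairResidues i j) y

theorem natCast_mem_pairResidues {i j p m : ℕ} :
    (m : ZMod p) ∈ pairResidues i j p ↔ p ∣ m + i ∨ p ∣ m + j := by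
  simp only [pairResidues, mem_insert, mem_singleton, eq_neg_iff_add_eq_zero, ← Nat.cast_add,
    ZMod.natCast_eq_zero_iff]

theorem card_pairResidues (i j p : ℕ) :
    #(pairResidues i j p) = if i ≡ j [MOD p] then 1 else 2 := by
  split_ifs with h
  · rw [pairResidues, (ZMod.natCast_eq_natCast_iff i j p).2 h, pair_eq_singleton, card_singleton]
  · exact card_pair fun hij => h ((ZMod.natCast_eq_natCast_iff i j p).1 (neg_injective hij))

theorem isTwoDimensionalSieve_pairResidues {i j : ℕ} (hij : i ≡ j [MOD 2]) :
    IsTwoDimensionalSieve (pairResidues i j) := by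
  intro p hp
  rw [card_pairResidues]
  split_ifs with h
  · exact ⟨one_le_two, hp.one_lt⟩
  · exact ⟨le_rfl, hp.two_le.lt_of_ne fun h2 => h (h2 ▸ hij)⟩

theorem pairDensity_of_not_modEq_two {y i j : ℕ} (hy : 2 ≤ y) (hij : ¬ i ≡ j [MOD 2]) :
    pairDensity y i j = 0 :=
  prod_eq_zero (Nat.mem_primesLE.2 ⟨hy, Nat.prime_two⟩) <| by
    rw [card_pairResidues, if_neg hij]
    norm_num

theorem pairDensity_le_siftedDensity {i j : ℕ} (hij : i ≡ j [MOD 2]) (y : ℕ) :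
    pairDensity y i j ≤ siftedDensity y := by
  rw [siftedDensity_eq_prod_primesLE, pairDensity, sievedDensity]
  refine prod_le_prod (fun p hp => ?_) fun p _ => ?_
  · exact sub_nonneg.2 ((isTwoDimensionalSieve_pairResidues hij).card_div_mem_Icc
      (Nat.prime_of_mem_primesLE hp)).2
  · gcongr
    exact_mod_cast card_pos.2 (insert_nonempty _ _)

theorem pairDensity_self (y i : ℕ) : pairDensity y i i = siftedDensity y := by
  rw [siftedDensity_eq_prod_primesLE, pairDensity, sievedDensity]
  refine prod_congr rfl fun p _ => ?_
  rw [card_pairResidues, if_pos (Nat.ModEq.refl i), Nat.cast_one]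

theorem pairDensity_succ_succ (y i j : ℕ) : pairDensity y (i + 1) (j + 1) = pairDensity y i j := by
  unfold pairDensity sievedDensity
  refine prod_congr rfl fun p _ => ?_
  rw [card_pairResidues, card_pairResidues,
    if_congr ⟨Nat.ModEq.add_right_cancel' 1, Nat.ModEq.add_right 1⟩ rfl rfl]

theorem sum_alphaSifted_mul_eq_sievedCount (y i j X : ℕ) :
    ∑ m ∈ range X, alphaSifted y (m + i) * alphaSifted y (m + j) =
      sievedCount (pairResidues i j) y X := by
  have hprod : ∀ m, alphaSifted y (m + i) * alphaSifted y (m + j) =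
      if ∀ p ∈ y.primesLE, (m : ZMod p) ∉ pairResidues i j p then 1 else 0 := by
    intro m
    simp only [alphaSifted_eq_ite, ite_zero_mul_ite_zero, mul_one, natCast_mem_pairResidues,
      not_or, forall₂_and]
  simp_rw [hprod, sum_boole, sievedCount]

theorem sievedCount_pairResidues_of_not_modEq_two {y i j : ℕ} (hy : 2 ≤ y)
    (hij : ¬ i ≡ j [MOD 2]) (X : ℕ) : sievedCount (pairResidues i j) y X = 0 := by
  refine card_eq_zero.2 (filter_eq_empty_iff.2 fun m _ h => ?_)
  refine h 2 (Nat.mem_primesLE.2 ⟨hy, Nat.prime_two⟩) (natCast_mem_pairResidues.2 ?_)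
  unfold Nat.ModEq at hij
  lia

/-- The error in approximating the number of `m < X` such that neither `m + i` nor `m + j` has a
prime factor `≤ y` by its density. -/
noncomputable def correlationError (y X i j : ℕ) : ℝ :=
  ∑ m ∈ range X, alphaSifted y (m + i) * alphaSifted y (m + j) - X * pairDensity y i j

theorem abs_correlationError_le {C u δ : ℝ} (hC : 0 ≤ C) (hu : 0 ≤ u)
    (h : FundamentalLemmaAt C u δ) {y : ℕ} (hy : 2 ≤ y) (X i j : ℕ) :
    |correlationError y X i j| ≤
      C * (X * (siftedDensity y * u ^ (-(u * (1 - δ)))) + friableOmegaSum ((y : ℝ) ^ u) y) := by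
  rw [correlationError, sum_alphaSifted_mul_eq_sievedCount]
  by_cases hij : i ≡ j [MOD 2]
  · refine (h _ (isTwoDimensionalSieve_pairResidues hij) y X (by lia)).trans ?_
    gcongr
    exact pairDensity_le_siftedDensity hij y
  · rw [sievedCount_pairResidues_of_not_modEq_two hy hij, pairDensity_of_not_modEq_two hy hij]
    have := siftedDensity_nonneg y
    have := friableOmegaSum_nonneg ((y : ℝ) ^ u) y
    simpa using by positivity

end Pairs

section CongruentPairs

theorem modEq_prod_primes_iff {S : Finset ℕ} (hS : ∀ p ∈ S, p.Prime) (i j : ℕ) :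
    i ≡ j [MOD ∏ p ∈ S, p] ↔ ∀ p ∈ S, i ≡ j [MOD p] := by
  induction S using Finset.induction_on with
  | empty => simp [Nat.modEq_one]
  | insert q S hq ih =>
    rw [forall_mem_insert] at hS
    have hcoprime : q.Coprime (∏ p ∈ S, p) := Nat.Coprime.prod_right fun p hp =>
      (Nat.coprime_primes hS.1 (hS.2 p hp)).2 (ne_of_mem_of_not_mem hp hq).symm
    rw [prod_insert hq, ← Nat.modEq_and_modEq_iff_modEq_mul hcoprime, ih hS.2, forall_mem_insert]

theorem card_filter_mod_lt_mod (H : ℕ) {q : ℕ} (hq : 0 < q) :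
    #{i ∈ range H | i % q < H % q} = (H % q) * (H / q + 1) := by
  rw [card_eq_sum_card_fiberwise (f := (· % q)) (t := range (H % q))
    fun i hi => mem_coe.2 (mem_range.2 (mem_filter.1 hi).2), sum_const_nat, card_range]
  intro r hr
  rw [mem_range] at hr
  have hrq : r % q = r := Nat.mod_eq_of_lt (hr.trans (Nat.mod_lt H hq))
  have hfiber : {i ∈ {i ∈ range H | i % q < H % q} | i % q = r} =
      {i ∈ range H | i ≡ r [MOD q]} := by
    rw [filter_filter]
    refine filter_congr fun i _ => ?_
    rw [Nat.ModEq, hrq]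
    exact and_iff_right_of_imp fun h => h ▸ hr
  rw [hfiber, ← Nat.count_eq_card_filter_range, Nat.count_modEq_card H hq, hrq, if_pos hr]

theorem sum_sum_ite_modEq (H : ℕ) {q : ℕ} (hq : 0 < q) :
    ∑ i ∈ range H, ∑ j ∈ range H, (if i ≡ j [MOD q] then (1 : ℝ) else 0) =
      H ^ 2 / q + q * (Int.fract ((H : ℝ) / q) * (1 - Int.fract ((H : ℝ) / q))) := by
  have hrow (i : ℕ) : ∑ j ∈ range H, (if i ≡ j [MOD q] then (1 : ℝ) else 0) =
      (H / q : ℕ) + if i % q < H % q then 1 else 0 := by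
    simp_rw [Nat.ModEq.comm (a := i)]
    rw [sum_boole, ← Nat.count_eq_card_filter_range, Nat.count_modEq_card H hq]
    push_cast
    rfl
  have hdiv : (H : ℝ) = q * (H / q : ℕ) + (H % q : ℕ) := by
    exact_mod_cast (Nat.div_add_mod H q).symm
  simp_rw [hrow, sum_add_distrib, sum_boole, card_filter_mod_lt_mod H hq]
  rw [sum_const, card_range, nsmul_eq_mul, Int.fract_div_natCast_eq_div_natCast_mod, Nat.cast_mul,
    Nat.cast_succ]
  generalize ((H / q : ℕ) : ℝ) = a at *
  generalize ((H % q : ℕ) : ℝ) = b at *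
  rw [hdiv]
  field_simp
  ring

end CongruentPairs

section MainTerm

/-- The odd primes `p ≤ y`, over which the products in `siftedMainTerm` run. -/
def oddPrimesUpTo (y : ℕ) : Finset ℕ := (Icc 1 y).filter fun p => p.Prime ∧ 2 < p

theorem mem_oddPrimesUpTo {y p : ℕ} : p ∈ oddPrimesUpTo y ↔ p.Prime ∧ 2 < p ∧ p ≤ y := by
  simp only [oddPrimesUpTo, mem_filter, mem_Icc]
  exact ⟨fun h => ⟨h.2.1, h.2.2, h.1.2⟩, fun h => ⟨⟨h.1.one_le, h.2.2⟩, h.1, h.2.1⟩⟩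

theorem prime_of_mem_powerset_oddPrimesUpTo {y : ℕ} {S : Finset ℕ}
    (hS : S ∈ (oddPrimesUpTo y).powerset) : ∀ p ∈ S, p.Prime :=
  fun _ hp => (mem_oddPrimesUpTo.1 (mem_powerset.1 hS hp)).1

theorem prod_primesLE_eq_mul_prod_oddPrimesUpTo {y : ℕ} (hy : 2 ≤ y) (f : ℕ → ℝ) :
    ∏ p ∈ y.primesLE, f p = f 2 * ∏ p ∈ oddPrimesUpTo y, f p := by
  rw [← prod_insert fun h => (mem_oddPrimesUpTo.1 h).2.1.false]
  congr 1
  ext p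
  rw [mem_insert, Nat.mem_primesLE, mem_oddPrimesUpTo]
  constructor
  · rintro ⟨hle, hp⟩
    exact hp.two_le.eq_or_lt.imp Eq.symm fun h2 => ⟨hp, h2, hle⟩
  · rintro (rfl | ⟨hp, _, hle⟩)
    · exact ⟨hy, Nat.prime_two⟩
    · exact ⟨hle, hp⟩

theorem pairDensity_eq_sum {y : ℕ} (hy : 2 ≤ y) (i j : ℕ) :
    pairDensity y i j = (∏ p ∈ oddPrimesUpTo y, (1 - 2 / (p : ℝ))) *
      ∑ S ∈ (oddPrimesUpTo y).powerset, (∏ p ∈ S, 1 / ((p : ℝ) - 2)) *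
        (1 / 2 * if i ≡ j [MOD 2 * ∏ p ∈ S, p] then 1 else 0) := by
  have htwo : 1 - (#(pairResidues i j 2) : ℝ) / (2 : ℕ) =
      1 / 2 * if i ≡ j [MOD 2] then 1 else 0 := by
    rw [card_pairResidues]
    split_ifs <;> norm_num
  have hodd : ∀ p ∈ oddPrimesUpTo y, 1 - (#(pairResidues i j p) : ℝ) / p = (1 - 2 / (p : ℝ)) *
      (1 + 1 / ((p : ℝ) - 2) * if i ≡ j [MOD p] then 1 else 0) := by
    intro p hp
    have hp2 : (2 : ℝ) < p := by exact_mod_cast (mem_oddPrimesUpTo.1 hp).2.1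
    have hsub : (p : ℝ) - 2 ≠ 0 := by linarith
    rw [card_pairResidues]
    split_ifs
    · push_cast
      field_simp
      ring
    · push_cast
      ring
  rw [pairDensity, sievedDensity, prod_primesLE_eq_mul_prod_oddPrimesUpTo hy, htwo,
    prod_congr rfl hodd, prod_mul_distrib, prod_one_add, mul_left_comm, mul_sum]
  congr 1
  refine sum_congr rfl fun S hS => ?_
  have hprime := prime_of_mem_powerset_oddPrimesUpTo hS
  have hcoprime : Nat.Coprime 2 (∏ p ∈ S, p) := Nat.Coprime.prod_right fun p hp =>
    (Nat.coprime_primes Nat.prime_two (hprime p hp)).2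
      (mem_oddPrimesUpTo.1 (mem_powerset.1 hS hp)).2.1.ne
  rw [prod_mul_distrib, prod_boole]
  simp only [← modEq_prod_primes_iff hprime, ← Nat.modEq_and_modEq_iff_modEq_mul hcoprime, ite_and]
  split_ifs <;> ring

theorem siftedDensity_sq_eq_sum {y : ℕ} (hy : 2 ≤ y) :
    siftedDensity y ^ 2 = (∏ p ∈ oddPrimesUpTo y, (1 - 2 / (p : ℝ))) *
      ∑ S ∈ (oddPrimesUpTo y).powerset,
        (∏ p ∈ S, 1 / ((p : ℝ) - 2)) * (1 / (4 * ∏ p ∈ S, (p : ℝ))) := by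
  have hodd : ∀ p ∈ oddPrimesUpTo y, (1 - 1 / (p : ℝ)) ^ 2 =
      (1 - 2 / (p : ℝ)) * (1 + 1 / ((p : ℝ) - 2) * (p : ℝ)⁻¹) := by
    intro p hp
    have hp2 : (2 : ℝ) < p := by exact_mod_cast (mem_oddPrimesUpTo.1 hp).2.1
    have hsub : (p : ℝ) - 2 ≠ 0 := by linarith
    field_simp
    ring
  rw [siftedDensity_eq_prod_primesLE, prod_primesLE_eq_mul_prod_oddPrimesUpTo hy, mul_pow,
    ← prod_pow, prod_congr rfl hodd, prod_mul_distrib, prod_one_add, mul_left_comm, mul_sum]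
  congr 1
  refine sum_congr rfl fun S _ => ?_
  rw [prod_mul_distrib, prod_inv_distrib]
  push_cast
  ring

theorem gSifted_prod {y : ℕ} {S : Finset ℕ} (hS : S ⊆ oddPrimesUpTo y) :
    gSifted y (∏ p ∈ S, p) = ∏ p ∈ S, (p : ℝ) / ((p : ℝ) - 2) := by
  have hprime := prime_of_mem_powerset_oddPrimesUpTo (mem_powerset.2 hS)
  rw [gSifted, if_pos (squarefree_prod_primes hprime), Nat.primeFactors_prod hprime]
  exact prod_congr rfl fun p hp => if_pos (mem_oddPrimesUpTo.1 (hS hp)).2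

theorem support_gSifted_subset (y : ℕ) :
    (gSifted y).support ⊆ (oddPrimesUpTo y).powerset.image fun S => ∏ p ∈ S, p := by
  intro n hn
  rw [Function.mem_support, gSifted] at hn
  obtain ⟨hsq, hprod⟩ := ite_ne_right_iff.1 hn
  refine mem_coe.2 (mem_image.2 ⟨n.primeFactors, mem_powerset.2 fun p hp => ?_,
    Nat.prod_primeFactors_of_squarefree hsq⟩)
  exact mem_oddPrimesUpTo.2 ⟨Nat.prime_of_mem_primeFactors hp,
    (ite_ne_right_iff.1 (prod_ne_zero_iff.1 hprod p hp)).1⟩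

theorem siftedMainTerm_eq_sum (H y : ℕ) :
    siftedMainTerm H y = (∏ p ∈ oddPrimesUpTo y, (1 - 2 / (p : ℝ))) *
      ∑ S ∈ (oddPrimesUpTo y).powerset, (∏ p ∈ S, (p : ℝ) / ((p : ℝ) - 2)) *
        (Int.fract ((H : ℝ) / (2 * ∏ p ∈ S, p : ℕ)) *
          (1 - Int.fract ((H : ℝ) / (2 * ∏ p ∈ S, p : ℕ)))) := by
  have hinj : Set.InjOn (fun S : Finset ℕ => ∏ p ∈ S, p) (oddPrimesUpTo y).powerset :=
    fun S hS T hT h => by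
      rw [← Nat.primeFactors_prod (prime_of_mem_powerset_oddPrimesUpTo hS),
        ← Nat.primeFactors_prod (prime_of_mem_powerset_oddPrimesUpTo hT)]
      exact congrArg Nat.primeFactors h
  rw [siftedMainTerm, tsum_eq_sum (s := (oddPrimesUpTo y).powerset.image fun S => ∏ p ∈ S, p)
    fun n hn => by
      rw [Function.notMem_support.1 fun h => hn (support_gSifted_subset y h), zero_mul],
    sum_image hinj]
  refine congrArg₂ _ rfl (sum_congr rfl fun S hS => ?_)
  rw [gSifted_prod (mem_powerset.1 hS), Nat.cast_mul, Nat.cast_ofNat]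

theorem sum_sum_pairDensity {y : ℕ} (hy : 2 ≤ y) (H : ℕ) :
    ∑ i ∈ range H, ∑ j ∈ range H, pairDensity y i j =
      (H * siftedDensity y) ^ 2 + siftedMainTerm H y := by
  have hswap : ∑ i ∈ range H, ∑ j ∈ range H, ∑ S ∈ (oddPrimesUpTo y).powerset,
      (∏ p ∈ S, 1 / ((p : ℝ) - 2)) * (1 / 2 * if i ≡ j [MOD 2 * ∏ p ∈ S, p] then 1 else 0) =
      ∑ S ∈ (oddPrimesUpTo y).powerset, (∏ p ∈ S, 1 / ((p : ℝ) - 2)) * (1 / 2 *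
        ∑ i ∈ range H, ∑ j ∈ range H, if i ≡ j [MOD 2 * ∏ p ∈ S, p] then (1 : ℝ) else 0) := by
    simp_rw [mul_sum]
    rw [sum_congr rfl fun i _ => sum_comm, sum_comm]
  simp_rw [pairDensity_eq_sum hy, ← mul_sum]
  rw [mul_pow, siftedDensity_sq_eq_sum hy, siftedMainTerm_eq_sum, hswap, mul_left_comm, ← mul_add,
    mul_sum _ _ ((H : ℝ) ^ 2), ← sum_add_distrib]
  refine congrArg₂ _ rfl (sum_congr rfl fun S hS => ?_)
  have hpos : 0 < ∏ p ∈ S, p :=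
    prod_pos fun p hp => (prime_of_mem_powerset_oddPrimesUpTo hS p hp).pos
  have hweight : ∏ p ∈ S, (p : ℝ) / ((p : ℝ) - 2) =
      (∏ p ∈ S, 1 / ((p : ℝ) - 2)) * (∏ p ∈ S, p : ℕ) := by
    rw [Nat.cast_prod, ← prod_mul_distrib]
    exact prod_congr rfl fun p _ => by rw [one_div_mul_eq_div]
  rw [sum_sum_ite_modEq H (by positivity : 0 < 2 * ∏ p ∈ S, p), hweight, ← Nat.cast_prod]
  generalize Int.fract ((H : ℝ) / (2 * ∏ p ∈ S, p : ℕ)) = φ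
  rw [Nat.cast_mul]
  push_cast
  field_simp
  ring

end MainTerm

section Variance

theorem intervalIntegral_eq_sum_of_eqOn_Ico {f : ℝ → ℝ} {a : ℕ → ℝ}
    (h : ∀ m : ℕ, ∀ x ∈ Set.Ico (m : ℝ) (m + 1), f x = a m) (X : ℕ) :
    ∫ x in (0 : ℝ)..(X : ℝ), f x = ∑ m ∈ range X, a m := by
  have hae : ∀ m : ℕ, (fun _ => a m) =ᵐ[MeasureTheory.volume.restrict
      (Set.uIoc (m : ℝ) ((m + 1 : ℕ) : ℝ))] f := by
    intro m
    rw [Set.uIoc_of_le (by simp), ← MeasureTheory.restrict_Ico_eq_restrict_Ioc]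
    filter_upwards [MeasureTheory.ae_restrict_mem measurableSet_Ico] with x hx
    exact (h m x (by exact_mod_cast hx)).symm
  rw [← Nat.cast_zero, ← intervalIntegral.sum_integral_adjacent_intervals fun m _ =>
    (intervalIntegrable_const (c := a m)).congr_ae (hae m)]
  refine sum_congr rfl fun m _ => ?_
  rw [← intervalIntegral.integral_congr_ae_restrict (hae m), intervalIntegral.integral_const]
  simp

theorem siftedVariance_eq_sum (X H y : ℕ) :
    siftedVariance X H y = 1 / X * ∑ m ∈ range X,
      (∑ i ∈ range H, alphaSifted y (m + (i + 1)) - H * siftedDensity y) ^ 2 := by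
  rw [siftedVariance]
  congr 1
  refine intervalIntegral_eq_sum_of_eqOn_Ico (fun m x hx => ?_) X
  have hx_nonneg : 0 ≤ x := (Nat.cast_nonneg m).trans hx.1
  rw [Nat.floor_add_natCast hx_nonneg, (Nat.floor_eq_iff hx_nonneg).2 hx,
    ← Ico_add_one_add_one_eq_Ioc, sum_Ico_eq_sum_range, show m + H + 1 - (m + 1) = H by lia]
  simp only [add_assoc, add_comm 1]

theorem mul_siftedVariance_sub_siftedMainTerm {y X : ℕ} (hy : 2 ≤ y) (hX : 1 ≤ X) (H : ℕ) :
    X * (siftedVariance X H y - siftedMainTerm H y) =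
      ∑ i ∈ range H, ∑ j ∈ range H, correlationError y X (i + 1) (j + 1) -
        2 * (H * siftedDensity y) * ∑ i ∈ range H, correlationError y X (i + 1) (i + 1) := by
  have hoffdiag : ∑ i ∈ range H, ∑ j ∈ range H, correlationError y X (i + 1) (j + 1) =
      ∑ m ∈ range X, (∑ i ∈ range H, alphaSifted y (m + (i + 1))) ^ 2 -
        X * ((H * siftedDensity y) ^ 2 + siftedMainTerm H y) := by
    simp_rw [correlationError, pairDensity_succ_succ, sum_sub_distrib, ← mul_sum]
    rw [sum_sum_pairDensity hy, sum_congr rfl fun i _ => sum_comm, sum_comm]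
    simp_rw [sq, sum_mul_sum]
  have hdiag : ∑ i ∈ range H, correlationError y X (i + 1) (i + 1) =
      ∑ m ∈ range X, ∑ i ∈ range H, alphaSifted y (m + (i + 1)) - X * (H * siftedDensity y) := by
    simp_rw [correlationError, pairDensity_self, alphaSifted_mul_self, sum_sub_distrib]
    rw [sum_comm, sum_const, card_range, nsmul_eq_mul, mul_left_comm]
  have hsquare : ∑ m ∈ range X,
        (∑ i ∈ range H, alphaSifted y (m + (i + 1)) - H * siftedDensity y) ^ 2 =
      ∑ m ∈ range X, (∑ i ∈ range H, alphaSifted y (m + (i + 1))) ^ 2 -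
        2 * (H * siftedDensity y) * ∑ m ∈ range X, ∑ i ∈ range H, alphaSifted y (m + (i + 1)) +
        X * (H * siftedDensity y) ^ 2 := by
    simp_rw [sub_sq, sum_add_distrib, sum_sub_distrib, mul_sum, sum_const, card_range, nsmul_eq_mul]
    congr 2
    exact sum_congr rfl fun m _ => by rw [← mul_sum, ← mul_sum]; ring
  rw [hoffdiag, hdiag, siftedVariance_eq_sum, hsquare]
  field_simp
  ring

theorem abs_siftedVariance_sub_siftedMainTerm_le {C u δ : ℝ} (hC : 0 ≤ C) (hu : 0 ≤ u)
    (h : FundamentalLemmaAt C u δ) {y X : ℕ} (hy : 2 ≤ y) (hX : 1 ≤ X) (H : ℕ) :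
    |siftedVariance X H y - siftedMainTerm H y| ≤
      3 * C * ((H : ℝ) ^ 2 * (siftedDensity y * u ^ (-(u * (1 - δ))) +
        friableOmegaSum ((y : ℝ) ^ u) y / X)) := by
  have hX_pos : (0 : ℝ) < X := by exact_mod_cast hX
  set R := C * (X * (siftedDensity y * u ^ (-(u * (1 - δ)))) + friableOmegaSum ((y : ℝ) ^ u) y)
    with hR
  set D : ℕ → ℕ → ℝ := fun i j => correlationError y X (i + 1) (j + 1)
  have hDR (i j : ℕ) : |D i j| ≤ R := abs_correlationError_le hC hu h hy X (i + 1) (j + 1)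
  have hoffdiag : |∑ i ∈ range H, ∑ j ∈ range H, D i j| ≤ H * (H * R) := by
    calc |∑ i ∈ range H, ∑ j ∈ range H, D i j|
        ≤ ∑ i ∈ range H, ∑ j ∈ range H, |D i j| :=
          (abs_sum_le_sum_abs _ _).trans (sum_le_sum fun i _ => abs_sum_le_sum_abs _ _)
      _ ≤ ∑ _i ∈ range H, ∑ _j ∈ range H, R := by gcongr; exact hDR _ _
      _ = H * (H * R) := by simp
  have hdiag : |∑ i ∈ range H, D i i| ≤ H * R := by
    calc |∑ i ∈ range H, D i i| ≤ ∑ i ∈ range H, |D i i| := abs_sum_le_sum_abs _ _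
      _ ≤ ∑ _i ∈ range H, R := by gcongr; exact hDR _ _
      _ = H * R := by simp
  have hdensity : 0 ≤ siftedDensity y := siftedDensity_nonneg y
  have hbound : X * |siftedVariance X H y - siftedMainTerm H y| ≤ 3 * (H : ℝ) ^ 2 * R := by
    rw [← Nat.abs_cast, ← abs_mul, mul_siftedVariance_sub_siftedMainTerm hy hX]
    calc |∑ i ∈ range H, ∑ j ∈ range H, D i j - 2 * (H * siftedDensity y) * ∑ i ∈ range H, D i i|
        ≤ |∑ i ∈ range H, ∑ j ∈ range H, D i j| +
          2 * (H * siftedDensity y) * |∑ i ∈ range H, D i i| := by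
          refine (abs_sub _ _).trans_eq ?_
          rw [abs_mul, abs_of_nonneg (by positivity : 0 ≤ 2 * (H * siftedDensity y))]
      _ ≤ H * (H * R) + 2 * (H * 1) * (H * R) := by
          gcongr
          exact siftedDensity_le_one y
      _ = 3 * (H : ℝ) ^ 2 * R := by ring
  rw [mul_comm, ← le_div_iff₀ hX_pos] at hbound
  refine hbound.trans_eq ?_
  rw [hR]
  field_simp

end Variance

theorem mainTheorem4 :
    ∃ (C : ℝ) (ε : ℝ → ℝ), 0 < C ∧ (∀ u : ℝ, 1 ≤ u → |ε u| ≤ 1) ∧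
      Filter.Tendsto ε Filter.atTop (nhds 0) ∧
      ∀ y H X : ℕ, 2 ≤ y → 1 ≤ H → 1 ≤ X → ∀ u : ℝ, 1 ≤ u →
        |siftedVariance X H y - siftedMainTerm H y| ≤
          C * ((H : ℝ) ^ 2 *
            (siftedDensity y * u ^ (-(u * (1 + ε u))) +
              friableOmegaSum ((y : ℝ) ^ u) y / (X : ℝ))) := by
  obtain ⟨C, hC, δ, hδ, hlim, hfundamental⟩ := exists_fundamentalLemmaAt
  refine ⟨3 * C, fun u => -δ u, by positivity, fun u _ => ?_, by simpa using hlim.neg,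
    fun y H X hy _ hX u hu => ?_⟩
  · rw [abs_neg, abs_of_nonneg (hδ u).1]
    exact (hδ u).2
  · simpa only [sub_eq_add_neg] using abs_siftedVariance_sub_siftedMainTerm_le hC.le
      (zero_le_one.trans hu) (hfundamental u hu) hy hX H
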